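/- For a finite graph $G$ let $\mu(G)$ be the maximum size of a matching in $G$, and call a real number $a$ an $(\alpha,\beta)$-approximation to the value of $\mu(G)$ if $a\le\mu(G)\le\alpha a+\beta$. A randomized adjacency-matrix algorithm knows the vertex set of the $n$-vertex input graph $G=(V,E)$ and accesses $E$ only through adaptive queries, each of which names an unordered pair of distinct vertices $\{u,v\}$ and returns whether $\{u,v\}\in E$; its cost is the number of queries it makes. Let $\Delta$ denote the maximum of $1$ and the maximum degree of $G$. For $\alpha\ge 1$ and a bound $T(n,\Delta)$, we say that an algorithm gives a $(\alpha,\varepsilon n)$-approximation to $\mu(G)$ with $\tilde O_\varepsilon(T(n,\Delta))$ queries, with high probability, if there is $k\in\mathbb N$ such that for every $c\in\mathbb N$ there are a function $C(\varepsilon)$ and a randomized adjacency-matrix algorithm (with parameters $\varepsilon$ and $n$) such that for every $\varepsilon>0$, every $n\ge1$ and every graph $G$ on $n$ vertices, with probability at least $1-n^{-c}$ the algorithm returns an $(\alpha,\varepsilon n)$-approximation to the value of $\mu(G)$ and makes at most $C(\varepsilon)\,T(n,\Delta)\,(1+\log n)^k$ queries. **Corollary.** Let $q\ge 0$ be a real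 number. Suppose that some adjacency-matrix algorithm gives, with high probability, a $(1,\varepsilon n)$-approximation to $\mu(G)$ with $\tilde O_\varepsilon(n\Delta^q)$ queries. Then some adjacency-matrix algorithm gives, with high probability, a $(3/2,\varepsilon n)$-approximation to $\mu(G)$ with $\tilde O_\varepsilon\bigl(n^{2-1/(1+q)}\bigr)$ queries. -/

import Mathlib

open scoped ENNReal

/-- The matching number `μ(G)`: the maximum number of edges of a matching in `G`. -/
noncomputable def matchingNumber {V : Type*} (G : SimpleGraph V) : ℕ :=
  sSup {k : ℕ | ∃ M : G.Subgraph, M.IsMatching ∧ M.edgeSet.ncard = k}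

/-- A deterministic adaptive adjacency-matrix query algorithm on the vertex set `Fin n`, which is
known to it. Either it stops and returns a real number, or it asks whether the unordered pair
`{u, v}` of distinct vertices is an edge and continues with `yes` or with `no` according to the
answer. -/
inductive QueryAlgorithm (n : ℕ) : Type
  | output (a : ℝ) : QueryAlgorithm n
  | query (u v : Fin n) (huv : u ≠ v) (yes no : QueryAlgorithm n) : QueryAlgorithm n

namespace QueryAlgorithm

/-- The value that the algorithm returns on the input graph `G`. -/
def result {n : ℕ} (G : SimpleGraph (Fin n)) [DecidableRel G.Adj] : QueryAlgorithm n → ℝ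
  | output a => a
  | query u v _ yes no => if G.Adj u v then yes.result G else no.result G

/-- The number of adjacency-matrix queries that the algorithm makes on the input graph `G`. -/
def queries {n : ℕ} (G : SimpleGraph (Fin n)) [DecidableRel G.Adj] : QueryAlgorithm n → ℕ
  | output _ => 0
  | query u v _ yes no => 1 + if G.Adj u v then yes.queries G else no.queries G

end QueryAlgorithm

/-- A randomized adjacency-matrix query algorithm: a probability distribution over deterministic
ones, that is, all the random choices are drawn independently of the input graph. -/
abbrev RandomizedQueryAlgorithm (n : ℕ) : Type := PMF (QueryAlgorithm n)

/-- The number `a` is an `(α, β)`-approximation to the value of `μ(G)`. -/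
def IsMatchingApprox {V : Type*} (G : SimpleGraph V) (α β a : ℝ) : Prop :=
  a ≤ matchingNumber G ∧ (matchingNumber G : ℝ) ≤ α * a + β

/-- There is a randomized adjacency-matrix query algorithm (with `n` and `ε` as parameters) that,
with high probability, returns an `(α, ε n)`-approximation to `μ(G)` after `Õ_ε(T n Δ)` queries,
for all input graphs `G` with `n` vertices and maximum degree `Δ`.
* `Õ_ε` hides a factor `C ε` that depends on `ε` only and a factor polylogarithmic in `n`.
* "With high probability" means with probability at least `1 - n ^ (-c)`, where the constant `c`
  can be chosen arbitrarily large; the algorithm and `C` may depend on `c`. -/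
def EstimatesMatchingWHP (α : ℝ) (T : ℕ → ℕ → ℝ) : Prop :=
  ∃ k : ℕ, ∀ c : ℕ,
    ∃ (A : ℝ → (n : ℕ) → RandomizedQueryAlgorithm n) (C : ℝ → ℝ),
      ∀ ε : ℝ, 0 < ε → ∀ n : ℕ, 0 < n →
        ∀ (G : SimpleGraph (Fin n)) [DecidableRel G.Adj],
          (A ε n).toOuterMeasure
              {t | ¬ (IsMatchingApprox G α (ε * n) (t.result G) ∧
                (t.queries G : ℝ) ≤ C ε * T n G.maxDegree * (1 + Real.log n) ^ k)}
            ≤ ((n : ℝ≥0∞) ^ c)⁻¹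

/-! ### Matchings as involutions, vertex deletion, and Kőnig's theorem. -/

section MatchingNumber

open scoped Classical

variable {V : Type*} [Fintype V]

/-! The given algorithm is run on a sparse subgraph of `G` with almost 2/3 of its matching number.
Put `d = n^(1/(1+q))` and `B = r²` with `r` about `22/ε`.

From about `n²/d` random pairs (up to logarithms) build an edge-degree constrained subgraph `H`:
adjacent degrees sum to at most `B`, and every sampled edge outside `H` has degree sum at least `B -
1`. Call an edge of `G` outside `H` underfull if its degree sum is smaller than that. No underfull
pair of `H` was sampled, and only `n^(nB)` encodings of graphs compete, so a union bound leaves at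
most `d n` underfull pairs (`uniform_miss_underfull_le`). Adding the underfull edges to `H` gives a
graph `K` with `μ(G) ≤ 3/2 μ(K) + 11 n / r` (`matchingNumber_le_of_edgeDegree`).

`K` is sparse on average, but its maximum degree may be large. A second, independent sample of order
`n²/d` pairs hits every vertex in many underfull pairs, yet only `O(ε n)` underfull pairs in total;
deleting the vertices it hits costs little matching and leaves maximum degree `Õ(d)`. Adjacency in
the remaining graph is decided by one query to `G` and known data, so the given algorithm can be
simulated there with `Õ(n d^q)` queries. The choice of `d` equates `n²/d` with `n d^q`.

The factor 3/2 comes from a random bipartition that separates the ends of a maximum matching of `G`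
and nearly halves the `H`-degrees. Kőnig's theorem covers the bipartite part of `K` by a set `C`;
counting `H`-edges between `C` and the set `X` of ends of uncovered matching edges gives `|X| ≤ |C|
+ O(n/r)`. -/

theorem SimpleGraph.Subgraph.IsMatching.ncard_verts {G : SimpleGraph V} {M : G.Subgraph}
    (hM : M.IsMatching) : M.verts.ncard = 2 * M.edgeSet.ncard := by
  have hdeg : ∀ v, M.spanningCoe.degree v = if v ∈ M.verts then 1 else 0 := by
    intro v
    split_ifs with hv
    · rw [SimpleGraph.degree_eq_one_iff_existsUnique_adj]
      exact hM hv
    · rw [SimpleGraph.degree_eq_zero]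
      intro w hw
      exact hv (M.edge_vert hw)
  have h := M.spanningCoe.sum_degrees_eq_twice_card_edges
  simp only [hdeg] at h
  rw [Finset.sum_boole] at h
  have h1 : M.edgeSet.ncard = M.spanningCoe.edgeFinset.card := by
    rw [← Set.ncard_coe_finset, SimpleGraph.coe_edgeFinset, SimpleGraph.Subgraph.edgeSet_spanningCoe]
  have h2 : M.verts.ncard = (Finset.univ.filter (· ∈ M.verts)).card := by
    rw [← Set.ncard_coe_finset]; simp
  rw [h1, h2]
  exact_mod_cast h

theorem bddAbove_matching_sizes (G : SimpleGraph V) :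
    BddAbove {k : ℕ | ∃ M : G.Subgraph, M.IsMatching ∧ M.edgeSet.ncard = k} := by
  refine ⟨Fintype.card (Sym2 V), ?_⟩
  rintro k ⟨M, -, rfl⟩
  rw [← Nat.card_eq_fintype_card]
  exact Set.ncard_le_card _

theorem SimpleGraph.Subgraph.IsMatching.ncard_edgeSet_le {G : SimpleGraph V} {M : G.Subgraph}
    (hM : M.IsMatching) : M.edgeSet.ncard ≤ matchingNumber G :=
  le_csSup (bddAbove_matching_sizes G) ⟨M, hM, rfl⟩

theorem exists_isMatching_ncard_eq_matchingNumber (G : SimpleGraph V) :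
    ∃ M : G.Subgraph, M.IsMatching ∧ M.edgeSet.ncard = matchingNumber G := by
  refine Nat.sSup_mem (s := {k : ℕ | ∃ M : G.Subgraph, M.IsMatching ∧ M.edgeSet.ncard = k})
    ⟨0, ⊥, ?_, ?_⟩ (bddAbove_matching_sizes G)
  · intro v hv
    simp at hv
  · simp

/-- A matching of `G`, encoded as the involution that swaps the endpoints of its edges. -/
structure IsMatchingInvolution (G : SimpleGraph V) (p : V → V) : Prop where
  involutive : Function.Involutive p
  adj : ∀ v, p v ≠ v → G.Adj v (p v)

theorem exists_isMatchingInvolution (G : SimpleGraph V) :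
    ∃ p, IsMatchingInvolution G p ∧
      (Finset.univ.filter fun v => p v ≠ v).card = 2 * matchingNumber G := by
  obtain ⟨M, hM, hcard⟩ := exists_isMatching_ncard_eq_matchingNumber G
  let p : V → V := fun v => if h : v ∈ M.verts then (hM h).choose else v
  have hp : ∀ v, v ∈ M.verts → M.Adj v (p v) := by
    intro v hv
    simp only [p, hv, dif_pos]
    exact (hM hv).choose_spec.1
  have hp' : ∀ v, v ∉ M.verts → p v = v := fun v hv => by simp [p, hv]
  have hne : ∀ v, p v ≠ v ↔ v ∈ M.verts := by
    intro v
    refine ⟨fun h => ?_, fun h => (hp v h).ne.symm⟩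
    by_contra hv
    exact h (hp' v hv)
  refine ⟨p, ⟨?_, ?_⟩, ?_⟩
  · intro v
    by_cases hv : v ∈ M.verts
    · have h1 := hp v hv
      have h2 := hp (p v) (M.edge_vert h1.symm)
      exact (hM.eq_of_adj_left h1.symm h2).symm
    · rw [hp' v hv, hp' v hv]
  · intro v hv
    exact (hp v ((hne v).1 hv)).adj_sub
  · rw [← hcard, ← hM.ncard_verts, ← Set.ncard_coe_finset]
    congr 1
    ext v
    simpa using hne v

theorem IsMatchingInvolution.card_le {G : SimpleGraph V} {p : V → V}
    (hp : IsMatchingInvolution G p) :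
    (Finset.univ.filter fun v => p v ≠ v).card ≤ 2 * matchingNumber G := by
  let M : G.Subgraph :=
    { verts := {v | p v ≠ v}
      Adj := fun v w => p v = w ∧ v ≠ w
      adj_sub := by
        rintro v w ⟨rfl, h⟩
        exact hp.adj v h.symm
      edge_vert := by
        rintro v w ⟨rfl, h⟩
        exact h.symm
      symm := ⟨by
        rintro v w ⟨rfl, h⟩
        exact ⟨hp.involutive v, h.symm⟩⟩ }
  have hM : M.IsMatching := by
    intro v hv
    exact ⟨p v, ⟨rfl, Ne.symm hv⟩, fun w hw => hw.1.symm⟩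
  have h := hM.ncard_edgeSet_le
  have h2 := hM.ncard_verts
  have h3 : M.verts.ncard = (Finset.univ.filter fun v => p v ≠ v).card := by
    rw [← Set.ncard_coe_finset]; congr 1; ext v; simp [M]
  omega

theorem matchingNumber_mono {G G' : SimpleGraph V} (h : G ≤ G') :
    matchingNumber G ≤ matchingNumber G' := by
  obtain ⟨p, hp, hc⟩ := exists_isMatchingInvolution G
  have := (IsMatchingInvolution.mk (G := G') hp.involutive fun v hv => h (hp.adj v hv)).card_le
  omega

/-- Deleting the vertices of `R` lowers the matching number by at most `|R|`. -/
theorem matchingNumber_le_add_card {G G' : SimpleGraph V} (R : Finset V)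
    (h : ∀ u v, u ∉ R → v ∉ R → G.Adj u v → G'.Adj u v) :
    matchingNumber G ≤ matchingNumber G' + R.card := by
  obtain ⟨p, hp, hc⟩ := exists_isMatchingInvolution G
  let p' : V → V := fun v => if v ∈ R ∨ p v ∈ R then v else p v
  have hp' : IsMatchingInvolution G' p' := by
    refine ⟨fun v => ?_, fun v hv => ?_⟩
    · by_cases h1 : v ∈ R ∨ p v ∈ R
      · simp [p', h1]
      · have h2 : p v ∉ R ∧ v ∉ R := by tauto
        simp [p', h2.1, h2.2, hp.involutive v]
    · by_cases h1 : v ∈ R ∨ p v ∈ R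
      · simp [p', h1] at hv
      · have h2 : p v ∉ R ∧ v ∉ R := by tauto
        simp only [p', h2.1, h2.2, or_self, if_false] at hv ⊢
        exact h _ _ h2.2 h2.1 (hp.adj v hv)
  have h1 := hp'.card_le
  have h2 : (Finset.univ.filter fun v => p v ≠ v) ⊆
      (Finset.univ.filter fun v => p' v ≠ v) ∪ (R ∪ R.image p) := by
    intro v hv
    simp only [Finset.mem_union, Finset.mem_filter, Finset.mem_univ, true_and,
      Finset.mem_image] at hv ⊢
    by_cases h1 : v ∈ R ∨ p v ∈ R
    · rcases h1 with h1 | h1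
      · exact Or.inr (Or.inl h1)
      · exact Or.inr (Or.inr ⟨p v, h1, hp.involutive v⟩)
    · left
      simpa [p', h1] using hv
  have h3 := Finset.card_le_card h2
  have h4 := Finset.card_union_le (Finset.univ.filter fun v => p' v ≠ v) (R ∪ R.image p)
  have h5 := Finset.card_union_le R (R.image p)
  have h6 := Finset.card_image_le (s := R) (f := p)
  omega

/-- **Kőnig's theorem**: a bipartite graph has a vertex cover of size at most its matching
number. -/
theorem exists_vertexCover_card_le_matchingNumber {G : SimpleGraph V} (c : V → Bool)
    (hc : ∀ u v, G.Adj u v → c u ≠ c v) :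
    ∃ C : Finset V, (∀ u v, G.Adj u v → u ∈ C ∨ v ∈ C) ∧ C.card ≤ matchingNumber G := by
  let L := {v : V // c v = true}
  let N : Finset L → Finset V := fun A => Finset.univ.filter fun v => ∃ a ∈ A, G.Adj a.1 v
  obtain ⟨A₀, -, hA₀⟩ := Finset.exists_max_image (Finset.univ : Finset (Finset L))
    (fun A => (A.card : ℤ) - (N A).card) ⟨∅, Finset.mem_univ _⟩
  obtain ⟨D, hD⟩ : ∃ D : ℕ, (D : ℤ) = (A₀.card : ℤ) - (N A₀).card := by
    refine ⟨((A₀.card : ℤ) - (N A₀).card).toNat, Int.toNat_of_nonneg ?_⟩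
    have := hA₀ ∅ (Finset.mem_univ _)
    simpa [N] using this
  -- `D` is the maximal deficiency. Joining `D` dummy vertices to all of `L` restores Hall's
  -- condition, and at most `D` vertices of `L` are then matched to dummies.
  let r : L → V ⊕ Fin D → Prop := fun a b => Sum.elim (fun v => G.Adj a.1 v) (fun _ => True) b
  obtain ⟨f, hf, hr⟩ := (Fintype.all_card_le_filter_rel_iff_exists_injective r).1 (by
    intro A
    rcases A.eq_empty_or_nonempty with rfl | ⟨a, ha⟩
    · simp
    · have h1 : (Finset.univ.filter fun b => ∃ a ∈ A, r a b) =
          (N A).disjSum (Finset.univ : Finset (Fin D)) := by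
        ext b
        rcases b with v | i
        · simp [r, N]
        · simpa [r] using ⟨a, ha⟩
      rw [h1, Finset.card_disjSum, Finset.card_univ, Fintype.card_fin]
      have := hA₀ A (Finset.mem_univ _)
      omega)
  let g : V → V := fun v => if h : c v = true then Sum.elim id (fun _ => v) (f ⟨v, h⟩) else v
  let S : Finset L := Finset.univ.filter fun a => ∃ w, f a = Sum.inl w
  let s : Set V := Subtype.val '' (S : Set L)
  have hg : ∀ a ∈ S, f a = Sum.inl (g a.1) := by
    intro a ha
    obtain ⟨w, hw⟩ := (Finset.mem_filter.1 ha).2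
    simp [g, a.2, hw]
  have hgadj : ∀ a ∈ S, G.Adj a.1 (g a.1) := by
    intro a ha
    have := hr a
    rw [hg a ha] at this
    exact this
  have hinj : Set.InjOn g s := by
    rintro _ ⟨a, ha, rfl⟩ _ ⟨b, hb, rfl⟩ hab
    have : f a = f b := by rw [hg a ha, hg b hb, hab]
    rw [hf this]
  have hdisj : Disjoint s (g '' s) := by
    rw [Set.disjoint_left]
    rintro _ ⟨a, ha, rfl⟩ ⟨_, ⟨b, hb, rfl⟩, hab⟩
    have := hc _ _ (hgadj b hb)
    rw [hab, a.2, b.2] at this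
    exact this rfl
  obtain ⟨M, hMv, hM⟩ := SimpleGraph.Subgraph.IsMatching.exists_of_disjoint_sets_of_equiv
    (G := G) hdisj (hinj.bijOn_image.equiv g) (by
      rintro ⟨_, ⟨a, ha, rfl⟩⟩
      exact hgadj a ha)
  have h1 := hM.ncard_verts
  have h2 := hM.ncard_edgeSet_le
  rw [hMv, Set.ncard_union_eq hdisj, hinj.ncard_image] at h1
  have h3 : s.ncard = S.card := by
    rw [Set.ncard_image_of_injective _ Subtype.val_injective, Set.ncard_coe_finset]
  have h4 : (Finset.univ : Finset L).card ≤ S.card + D := by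
    rw [← Finset.card_filter_add_card_filter_not (s := Finset.univ) (fun a => ∃ w, f a = Sum.inl w)]
    refine Nat.add_le_add_left ?_ _
    have h5 : ((Finset.univ.filter fun a => ¬ ∃ w, f a = Sum.inl w).image f) ⊆
        (Finset.univ : Finset (Fin D)).map ⟨Sum.inr, Sum.inr_injective⟩ := by
      intro b hb
      obtain ⟨a, ha, rfl⟩ := Finset.mem_image.1 hb
      have ha := (Finset.mem_filter.1 ha).2
      rcases hfa : f a with w | i
      · exact absurd ⟨w, hfa⟩ ha
      · simp
    have h6 := Finset.card_le_card h5
    rwa [Finset.card_image_of_injective _ hf, Finset.card_map, Finset.card_univ,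
      Fintype.card_fin] at h6
  -- This cover has at most `|L| - |A₀| + |N A₀| = |L| - D` vertices, hence at most `|S|`, the
  -- number of genuinely matched ones.
  refine ⟨(Finset.univ \ A₀).map ⟨Subtype.val, Subtype.val_injective⟩ ∪ N A₀, ?_, ?_⟩
  · have key : ∀ u v, c u = true → G.Adj u v →
        u ∈ (Finset.univ \ A₀).map ⟨Subtype.val, Subtype.val_injective⟩ ∨ v ∈ N A₀ := by
      intro u v hu huv
      by_cases h : (⟨u, hu⟩ : L) ∈ A₀
      · right
        simp only [N, Finset.mem_filter, Finset.mem_univ, true_and]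
        exact ⟨_, h, huv⟩
      · left
        simp only [Finset.mem_map, Finset.mem_sdiff, Finset.mem_univ, true_and]
        exact ⟨⟨u, hu⟩, h, rfl⟩
    intro u v huv
    simp only [Finset.mem_union]
    by_cases hu : c u = true
    · have := key u v hu huv
      tauto
    · have hv : c v = true := by
        have := hc u v huv
        revert this hu
        cases c u <;> cases c v <;> simp
      have := key v u hv huv.symm
      tauto
  · have h5 := Finset.card_union_le
      ((Finset.univ \ A₀).map ⟨Subtype.val, Subtype.val_injective⟩) (N A₀)
    rw [Finset.card_map, Finset.card_sdiff_of_subset (Finset.subset_univ _)] at h5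
    have h6 := Finset.card_le_card (Finset.subset_univ A₀)
    omega

end MatchingNumber

/-! ### The 3/2 bound for edge-degree constrained subgraphs. -/

section Sparsifier

open scoped Classical

variable {V : Type*} [Fintype V]

/-- Flipping the sign at `a` negates every term. -/
theorem sum_units_mul_eq_zero {a b : V} (hab : a ≠ b) :
    ∑ τ : V → ℤˣ, ((τ a : ℤ) * (τ b : ℤ)) = 0 := by
  have h := Equiv.sum_comp (Equiv.mulRight (Pi.mulSingle a (-1) : V → ℤˣ))
    (fun τ : V → ℤˣ => ((τ a : ℤ) * (τ b : ℤ)))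
  simp only [Equiv.coe_mulRight, Pi.mul_apply, Pi.mulSingle_eq_same,
    Pi.mulSingle_eq_of_ne hab.symm, mul_one, mul_neg, Units.val_neg, neg_mul,
    Finset.sum_neg_distrib] at h
  linarith

/-- A random two-colouring that separates every vertex from its image under the involution `p`
splits the neighbourhoods evenly on average. -/
theorem exists_balanced_signs (H : SimpleGraph V) {p : V → V} (hp : Function.Involutive p)
    {B : ℕ} (hB : ∀ v, H.degree v ≤ B) :
    ∃ σ : V → ℤ, (∀ v, σ v = 1 ∨ σ v = -1) ∧ (∀ v, p v ≠ v → σ (p v) = -σ v) ∧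
      ∑ v, (∑ w ∈ H.neighborFinset v, σ w) ^ 2 ≤ (Fintype.card V : ℤ) * B := by
  let e := Fintype.equivFin V
  -- One free sign per orbit of `p`, read at its representative; `sgn` makes partners opposite.
  let rep : V → V := fun w => if e w ≤ e (p w) then w else p w
  let sgn : V → ℤ := fun w => if e w ≤ e (p w) then 1 else -1
  let σ : (V → ℤˣ) → V → ℤ := fun τ w => sgn w * (τ (rep w) : ℤ)
  have hsgn : ∀ w, sgn w * sgn w = 1 := by
    intro w
    simp only [sgn]
    split_ifs <;> rfl
  have hpp : ∀ v, p v ≠ v → rep (p v) = rep v ∧ sgn (p v) = -sgn v := by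
    intro v hv
    have hne : e (p v) ≠ e v := fun h => hv (e.injective h)
    simp only [rep, sgn, hp v]
    rcases lt_or_gt_of_ne hne with h | h
    · simp [h.le, not_le.2 h]
    · simp [h.le, not_le.2 h]
  have hrep : ∀ v w, v ≠ w → rep v = rep w → w = p v := by
    intro v w hvw h
    simp only [rep] at h
    split_ifs at h
    · exact absurd h hvw
    · rw [h, hp w]
    · exact h.symm
    · exact absurd (hp.injective h) hvw
  -- Different orbits are uncorrelated and partners contribute negatively, so only the diagonal
  -- survives and the mean square at `v` is at most its degree.
  have hcorr : ∀ w w', ∑ τ, σ τ w * σ τ w' ≤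
      if w = w' then (Fintype.card (V → ℤˣ) : ℤ) else 0 := by
    intro w w'
    have h1 : ∀ τ, σ τ w * σ τ w' = sgn w * sgn w' * ((τ (rep w) : ℤ) * (τ (rep w') : ℤ)) :=
      fun τ => by simp only [σ]; ring
    simp only [h1, ← Finset.mul_sum]
    split_ifs with h
    · subst h
      simp [hsgn]
    · by_cases hr : rep w = rep w'
      · have h2 := hrep w w' h hr
        have h3 : p w ≠ w := fun h4 => h (by rw [h2, h4])
        rw [hr, h2, (hpp w h3).2]
        have := hsgn w
        simp only [← Units.val_mul, Int.units_mul_self, mul_neg, this]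
        simp
      · rw [sum_units_mul_eq_zero hr, mul_zero]
  obtain ⟨τ, -, hτ⟩ := Finset.exists_le_of_sum_le (s := (Finset.univ : Finset (V → ℤˣ)))
    (f := fun τ => ∑ v, (∑ w ∈ H.neighborFinset v, σ τ w) ^ 2)
    (g := fun _ => (Fintype.card V : ℤ) * B) Finset.univ_nonempty (by
      rw [Finset.sum_comm]
      have h1 : ∀ v, ∑ τ, (∑ w ∈ H.neighborFinset v, σ τ w) ^ 2 ≤
          Fintype.card (V → ℤˣ) * (B : ℤ) := by
        intro v
        simp only [pow_two, Finset.sum_mul_sum]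
        rw [Finset.sum_comm]
        calc _ ≤ ∑ w ∈ H.neighborFinset v, (Fintype.card (V → ℤˣ) : ℤ) := by
              refine Finset.sum_le_sum fun w hw => ?_
              rw [Finset.sum_comm]
              refine (Finset.sum_le_sum fun w' _ => hcorr w w').trans ?_
              rw [Finset.sum_ite_eq]
              simp [(SimpleGraph.mem_neighborFinset _ _ _).1 hw]
          _ = H.degree v * (Fintype.card (V → ℤˣ) : ℤ) := by
              rw [Finset.sum_const, SimpleGraph.card_neighborFinset_eq_degree, nsmul_eq_mul]
          _ ≤ _ := by
              rw [mul_comm]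
              exact mul_le_mul_of_nonneg_left (by exact_mod_cast hB v) (by positivity)
      refine (Finset.sum_le_sum fun v _ => h1 v).trans ?_
      rw [Finset.sum_const, Finset.sum_const, Finset.card_univ, Finset.card_univ, nsmul_eq_mul,
        nsmul_eq_mul]
      apply le_of_eq
      ring)
  refine ⟨σ τ, fun v => ?_, fun v hv => ?_, hτ⟩
  · simp only [σ, sgn]
    rcases Int.units_eq_one_or (τ (rep v)) with h | h <;> rw [h] <;> split_ifs <;> simp
  · simp only [σ, (hpp v hv).1, (hpp v hv).2]
    ring

theorem degree_le_of_edgeDegree_le {H : SimpleGraph V} {B : ℕ}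
    (hH : ∀ u v, H.Adj u v → H.degree u + H.degree v ≤ B) (v : V) : H.degree v ≤ B := by
  by_cases h : ∃ w, H.Adj v w
  · obtain ⟨w, hw⟩ := h
    have := hH v w hw
    omega
  · push Not at h
    have : H.degree v = 0 := (H.degree_eq_zero v).2 h
    omega

/-- The edge-degree constrained subgraph `H`, with `K ⊇ H` containing all the edges of `G` of small
`H`-degree, preserves the matching number up to a factor `3 / 2` and a small additive error. -/
theorem matchingNumber_le_of_edgeDegree {G H K : SimpleGraph V} {r : ℕ} (hr : 1 ≤ r)
    (hHK : H ≤ K) (hH : ∀ u v, H.Adj u v → H.degree u + H.degree v ≤ r ^ 2)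
    (hG : ∀ u v, G.Adj u v → ¬ K.Adj u v → r ^ 2 ≤ H.degree u + H.degree v + 1) :
    (matchingNumber G : ℝ) ≤ 3 / 2 * matchingNumber K + 11 * Fintype.card V / r := by
  have hdeg := degree_le_of_edgeDegree_le hH
  obtain ⟨p, hp, hpc⟩ := exists_isMatchingInvolution G
  obtain ⟨σ, hσ, hσp, hσs⟩ := exists_balanced_signs H hp.involutive hdeg
  have hσ2 : ∀ v, σ v ≠ 0 := fun v => by rcases hσ v with h | h <;> rw [h] <;> decide
  let Bip : SimpleGraph V :=
    { Adj := fun u v => K.Adj u v ∧ σ u ≠ σ v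
      symm := ⟨fun u v h => ⟨h.1.symm, h.2.symm⟩⟩
      loopless := ⟨fun u h => h.2 rfl⟩ }
  obtain ⟨C, hC, hCcard⟩ := exists_vertexCover_card_le_matchingNumber (G := Bip)
    (fun v => decide (σ v = 1)) (by
      rintro u v ⟨-, h⟩
      rcases hσ u with hu | hu <;> rcases hσ v with hv | hv <;> simp [hu, hv] at h ⊢)
  have hCK : C.card ≤ matchingNumber K :=
    hCcard.trans (matchingNumber_mono fun u v h => h.1)
  -- The ends of the matching edges that the cover misses.
  let X : Finset V := Finset.univ.filter fun v => p v ≠ v ∧ v ∉ C ∧ p v ∉ C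
  have hX : ∀ v, v ∈ X ↔ p v ≠ v ∧ v ∉ C ∧ p v ∉ C := by simp [X]
  have hXp : ∀ v ∈ X, p v ∈ X := by
    intro v hv
    rw [hX] at hv ⊢
    rw [hp.involutive v]
    exact ⟨hv.1.symm, hv.2.2, hv.2.1⟩
  have hcount : 2 * matchingNumber G ≤ X.card + 2 * C.card := by
    rw [← hpc]
    have h1 : (Finset.univ.filter fun v => p v ≠ v) ⊆ X ∪ (C ∪ C.image p) := by
      intro v hv
      have hv := (Finset.mem_filter.1 hv).2
      simp only [Finset.mem_union, hX, Finset.mem_image]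
      by_cases h1 : v ∈ C
      · tauto
      · by_cases h2 : p v ∈ C
        · exact Or.inr (Or.inr ⟨p v, h2, hp.involutive v⟩)
        · tauto
    have h2 := Finset.card_le_card h1
    have h3 := Finset.card_union_le X (C ∪ C.image p)
    have h4 := Finset.card_union_le C (C.image p)
    have h5 := Finset.card_image_le (s := C) (f := p)
    omega
  let d : V → ℝ := fun v => H.degree v
  let T : V → ℝ := fun v => ∑ w ∈ H.neighborFinset v, (σ w : ℝ)
  let a : V → V → ℝ := fun u v => if H.Adj u v ∧ σ u ≠ σ v then 1 else 0
  let b : V → ℝ := fun v => ∑ w, a v w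
  let e : V → ℝ := fun c => ∑ x ∈ X, a x c
  let β : ℝ := (r : ℝ) ^ 2
  let δ : ℝ := ∑ v, |T v|
  have hr0 : (1 : ℝ) ≤ r := by exact_mod_cast hr
  have hβ : 0 < β := by positivity
  have ha0 : ∀ u v, 0 ≤ a u v := fun u v => by simp only [a]; split_ifs <;> norm_num
  have hasymm : ∀ u v, a u v = a v u := by
    intro u v
    simp only [a, H.adj_comm u v, ne_comm (a := σ u)]
  have hdβ : ∀ v, d v ≤ β := fun v => by
    simp only [d, β]
    exact_mod_cast hdeg v
  -- `b v` counts the `H`-neighbours across the bipartition, and `T v` measures how far they are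
  -- from being half of all.
  have hb : ∀ v, 2 * b v = d v - σ v * T v := by
    intro v
    have h1 : d v = ∑ w, if H.Adj v w then (1 : ℝ) else 0 := by
      rw [Finset.sum_boole]
      simp only [d, ← SimpleGraph.card_neighborFinset_eq_degree, SimpleGraph.neighborFinset_eq_filter]
    have h2 : T v = ∑ w, if H.Adj v w then (σ w : ℝ) else 0 := by
      simp only [T, SimpleGraph.neighborFinset_eq_filter, Finset.sum_filter]
    rw [h1, h2, Finset.mul_sum, Finset.mul_sum, ← Finset.sum_sub_distrib]
    refine Finset.sum_congr rfl fun w _ => ?_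
    by_cases h : H.Adj v w
    · rcases hσ v with hv | hv <;> rcases hσ w with hw | hw <;> simp [a, h, hv, hw] <;> norm_num
    · simp [a, h]
  have hσT : ∀ v, |(σ v : ℝ) * T v| = |T v| := by
    intro v
    rcases hσ v with hv | hv <;> simp [hv]
  have hbd1 : ∀ v, d v - |T v| ≤ 2 * b v := fun v => by
    rw [hb v, ← hσT v]; linarith [le_abs_self ((σ v : ℝ) * T v)]
  have hbd2 : ∀ v, 2 * b v - |T v| ≤ d v := fun v => by
    rw [hb v, ← hσT v]; linarith [neg_abs_le ((σ v : ℝ) * T v)]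
  have hb0 : ∀ v, 0 ≤ b v := fun v => Finset.sum_nonneg fun w _ => ha0 v w
  have hbβ : ∀ v, b v ≤ β := by
    intro v
    refine le_trans ?_ (hdβ v)
    have h1 : d v = ∑ w, if H.Adj v w then (1 : ℝ) else 0 := by
      rw [Finset.sum_boole]
      simp only [d, ← SimpleGraph.card_neighborFinset_eq_degree, SimpleGraph.neighborFinset_eq_filter]
    rw [h1]
    refine Finset.sum_le_sum fun w _ => ?_
    by_cases h : H.Adj v w <;> simp only [a, h, true_and, false_and, if_true, if_false]
    · split_ifs <;> norm_num
    · exact le_rfl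
  have he0 : ∀ v, 0 ≤ e v := fun v => Finset.sum_nonneg fun w _ => ha0 w v
  have heb : ∀ v, e v ≤ b v := by
    intro v
    simp only [e, b, hasymm v]
    exact Finset.sum_le_sum_of_subset_of_nonneg (Finset.subset_univ _) fun w _ _ => ha0 w v
  have hbC : ∀ x ∈ X, b x = ∑ c ∈ C, a x c := by
    intro x hx
    refine (Finset.sum_subset (Finset.subset_univ C) fun w _ hw => ?_).symm
    simp only [a]
    rw [if_neg]
    rintro ⟨h1, h2⟩
    rcases hC x w ⟨hHK h1, h2⟩ with h | h
    · exact ((hX x).1 hx).2.1 h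
    · exact hw h
  have hE : ∑ x ∈ X, b x = ∑ c ∈ C, e c := by
    rw [Finset.sum_congr rfl hbC, Finset.sum_comm]
  -- Sum the degree constraint over the crossing `H`-edges between `X` and `C`.
  have hupper : ∑ x ∈ X, d x * b x + ∑ c ∈ C, d c * e c ≤ β * ∑ x ∈ X, b x := by
    have h1 : ∑ x ∈ X, d x * b x = ∑ x ∈ X, ∑ c ∈ C, a x c * d x := by
      refine Finset.sum_congr rfl fun x hx => ?_
      rw [hbC x hx, Finset.mul_sum]
      exact Finset.sum_congr rfl fun c _ => mul_comm _ _
    have h2 : ∑ c ∈ C, d c * e c = ∑ x ∈ X, ∑ c ∈ C, a x c * d c := by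
      rw [Finset.sum_comm]
      refine Finset.sum_congr rfl fun c _ => ?_
      rw [Finset.mul_sum]
      exact Finset.sum_congr rfl fun x _ => mul_comm _ _
    rw [h1, h2, ← Finset.sum_add_distrib, Finset.mul_sum]
    refine Finset.sum_le_sum fun x hx => ?_
    rw [hbC x hx, ← Finset.sum_add_distrib, Finset.mul_sum]
    refine Finset.sum_le_sum fun c _ => ?_
    by_cases h : H.Adj x c ∧ σ x ≠ σ c
    · simp only [a, if_pos h, one_mul, mul_one, d, β]
      exact_mod_cast hH x c h.1
    · simp [a, if_neg h]
  -- The mean of `T²` is at most `r²`, so AM-GM with weight `r` bounds the mean of `|T|` by `r`.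
  have hδ : δ ≤ Fintype.card V * r := by
    have h1 : ∀ v, |T v| ≤ T v ^ 2 / (2 * r) + r / 2 := by
      intro v
      rw [← sq_abs]
      have : |T v| ^ 2 / (2 * r) + r / 2 - |T v| = (|T v| - r) ^ 2 / (2 * r) := by
        field_simp
        ring
      have h2 : 0 ≤ (|T v| - r) ^ 2 / (2 * r : ℝ) := by positivity
      linarith
    have h2 : ∑ v, T v ^ 2 ≤ Fintype.card V * (r : ℝ) ^ 2 := by
      simp only [T]
      exact_mod_cast hσs
    calc δ ≤ ∑ v, (T v ^ 2 / (2 * r) + r / 2) := Finset.sum_le_sum fun v _ => h1 v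
      _ = (∑ v, T v ^ 2) / (2 * r) + Fintype.card V * (r / 2 : ℝ) := by
          rw [Finset.sum_add_distrib, Finset.sum_div, Finset.sum_const, Finset.card_univ,
            nsmul_eq_mul]
      _ ≤ (Fintype.card V * (r : ℝ) ^ 2) / (2 * r) + Fintype.card V * (r / 2 : ℝ) := by gcongr
      _ = Fintype.card V * r := by field_simp; ring
  have hTX : ∀ S : Finset V, ∑ v ∈ S, |T v| ≤ δ := fun S =>
    Finset.sum_le_sum_of_subset_of_nonneg (Finset.subset_univ _) fun w _ _ => abs_nonneg _
  -- As `d ≥ 2b - |T|`, this reduces to `2b² ≥ βb - β²/8`, that is `2(b - β/4)² ≥ 0`.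
  have hlow1 : β * (∑ x ∈ X, b x) - β ^ 2 / 8 * X.card - β * δ ≤ ∑ x ∈ X, d x * b x := by
    have h1 : ∀ x, β * b x - β ^ 2 / 8 - β * |T x| ≤ d x * b x := by
      intro x
      have h2 := mul_le_mul_of_nonneg_right (hbd2 x) (hb0 x)
      have h3 := mul_le_mul_of_nonneg_left (hbβ x) (abs_nonneg (T x))
      nlinarith [sq_nonneg (b x - β / 4)]
    have h4 := Finset.sum_le_sum fun x (_ : x ∈ X) => h1 x
    rw [Finset.sum_sub_distrib, Finset.sum_sub_distrib, ← Finset.mul_sum, ← Finset.mul_sum,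
      Finset.sum_const, nsmul_eq_mul] at h4
    have h5 := mul_le_mul_of_nonneg_left (hTX X) hβ.le
    linarith
  have hlow2 : β * (∑ c ∈ C, e c) - β ^ 2 / 8 * C.card - β * δ ≤ ∑ c ∈ C, d c * e c := by
    have h1 : ∀ x, β * e x - β ^ 2 / 8 - β * |T x| ≤ d x * e x := by
      intro x
      have h2 := mul_le_mul_of_nonneg_right (hbd2 x) (he0 x)
      have h3 := mul_le_mul_of_nonneg_left ((heb x).trans (hbβ x)) (abs_nonneg (T x))
      have h4 := mul_le_mul_of_nonneg_right (heb x) (he0 x)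
      nlinarith [sq_nonneg (e x - β / 4)]
    have h4 := Finset.sum_le_sum fun x (_ : x ∈ C) => h1 x
    rw [Finset.sum_sub_distrib, Finset.sum_sub_distrib, ← Finset.mul_sum, ← Finset.mul_sum,
      Finset.sum_const, nsmul_eq_mul] at h4
    have h5 := mul_le_mul_of_nonneg_left (hTX C) hβ.le
    linarith
  -- A missed matching edge crosses the bipartition, so it is not in `K` and `hG` bounds its degree
  -- sum below. As `p` permutes `X`, each degree is counted twice.
  have hXd : X.card * (β - 1) ≤ 2 * ∑ x ∈ X, d x := by
    have h1 : ∑ x ∈ X, d (p x) = ∑ x ∈ X, d x :=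
      Finset.sum_nbij' p p hXp hXp (fun x _ => hp.involutive x) (fun x _ => hp.involutive x)
        fun x _ => rfl
    have h2 : ∀ x ∈ X, β - 1 ≤ d x + d (p x) := by
      intro x hx
      obtain ⟨h3, h4, h5⟩ := (hX x).1 hx
      have h6 := hG x (p x) (hp.adj x h3) (fun h => by
        have h7 : σ x ≠ σ (p x) := by
          rw [hσp x h3]
          have := hσ2 x
          omega
        rcases hC x (p x) ⟨h, h7⟩ with h | h <;> contradiction)
      have h7 : (r : ℝ) ^ 2 ≤ (H.degree x : ℝ) + H.degree (p x) + 1 := by exact_mod_cast h6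
      simp only [d, β]
      linarith
    have h3 := Finset.sum_le_sum h2
    rw [Finset.sum_const, nsmul_eq_mul, Finset.sum_add_distrib, h1] at h3
    linarith
  have hEl : (∑ x ∈ X, d x) - δ ≤ 2 * ∑ x ∈ X, b x := by
    have h3 := Finset.sum_le_sum fun x (_ : x ∈ X) => hbd1 x
    rw [Finset.sum_sub_distrib, ← Finset.mul_sum] at h3
    linarith [hTX X]
  rw [← hE] at hlow2
  have hEu : β * (∑ x ∈ X, b x) ≤ β * (β / 8 * (X.card + C.card) + 2 * δ) := by
    linarith
  have hEu := le_of_mul_le_mul_left hEu hβ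
  have hXn : (X.card : ℝ) ≤ Fintype.card V := by exact_mod_cast Finset.card_le_univ X
  -- With `E` the sum of `b` over `X`: `|X|(β - 1) ≤ 4E + 2δ` and `E ≤ β(|X| + |C|)/8 + 2δ`.
  -- Doubling gives the error `20δ`.
  have hmain : (X.card : ℝ) * β ≤ C.card * β + 2 * Fintype.card V + 20 * (Fintype.card V * r) := by
    linarith
  have hmain2 : (X.card : ℝ) ≤ C.card + 22 * Fintype.card V / r := by
    refine le_of_mul_le_mul_right (hmain.trans ?_) hβ
    have h1 : ((C.card : ℝ) + 22 * Fintype.card V / r) * β =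
        C.card * β + 22 * (Fintype.card V * r) := by
      simp only [β]
      field_simp
    rw [h1]
    have : (Fintype.card V : ℝ) ≤ Fintype.card V * r := le_mul_of_one_le_right (by positivity) hr0
    linarith
  have hc1 : 2 * (matchingNumber G : ℝ) ≤ X.card + 2 * C.card := by exact_mod_cast hcount
  have hc2 : (C.card : ℝ) ≤ matchingNumber K := by exact_mod_cast hCK
  have : 11 * (Fintype.card V : ℝ) / r = 22 * Fintype.card V / r / 2 := by ring
  linarith

end Sparsifier

/-! ### Existence of edge-degree constrained subgraphs. -/

section EdgeDegreeConstrained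

open scoped Classical

variable {V : Type*} [Fintype V]

theorem SimpleGraph.degree_of_eq_sup_edge {H H' : SimpleGraph V} {u v : V}
    (hH' : H' = H ⊔ SimpleGraph.edge u v) (huv : u ≠ v) (h : ¬ H.Adj u v) (w : V) :
    H'.degree w =
      H.degree w + (if w = u then 1 else 0) + if w = v then 1 else 0 := by
  have hd : ∀ K : SimpleGraph V, K.degree w = ∑ x, if K.Adj w x then 1 else 0 := by
    intro K
    rw [← SimpleGraph.card_neighborFinset_eq_degree, SimpleGraph.neighborFinset_eq_filter,
      Finset.card_filter]
  have h1 : (if w = u then 1 else 0) = ∑ x, if w = u ∧ x = v then 1 else 0 := by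
    by_cases h : w = u <;> simp [h]
  have h2 : (if w = v then 1 else 0) = ∑ x, if w = v ∧ x = u then 1 else 0 := by
    by_cases h : w = v <;> simp [h]
  rw [hd, hd, h1, h2, ← Finset.sum_add_distrib, ← Finset.sum_add_distrib]
  refine Finset.sum_congr rfl fun x _ => ?_
  simp only [hH', SimpleGraph.sup_adj, SimpleGraph.edge_adj]
  have h' : ¬ H.Adj v u := fun h' => h h'.symm
  by_cases h3 : w = u ∧ x = v
  · obtain ⟨rfl, rfl⟩ := h3
    simp [h, huv]
  · by_cases h4 : w = v ∧ x = u
    · obtain ⟨rfl, rfl⟩ := h4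
      simp [h', huv, huv.symm]
    · simp [h3, h4]

/-- The potential is tuned so that inserting an edge gains at least 2 if the old degree sum is at
most `B - 2`, and loses at least 2 if it is at least `B - 1`. A maximiser thus satisfies both degree
conditions. The equation for `H'` lets the lemma serve insertion and deletion alike. -/
theorem sum_potential_of_eq_sup_edge {H H' : SimpleGraph V} {u v : V}
    (hH' : H' = H ⊔ SimpleGraph.edge u v) (huv : u ≠ v) (h : ¬ H.Adj u v)
    (B : ℤ) :
    ∑ w, ((2 * B - 1) * (H'.degree w : ℤ) -
        2 * (H'.degree w : ℤ) ^ 2) =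
      (∑ w, ((2 * B - 1) * (H.degree w : ℤ) - 2 * (H.degree w : ℤ) ^ 2)) +
        (4 * B - 6 - 4 * (H.degree u + H.degree v)) := by
  have h1 : ∀ w, (2 * B - 1) * (H'.degree w : ℤ) -
      2 * (H'.degree w : ℤ) ^ 2 =
      ((2 * B - 1) * (H.degree w : ℤ) - 2 * (H.degree w : ℤ) ^ 2) +
        (if w = u then 2 * B - 3 - 4 * (H.degree w : ℤ) else 0) +
        (if w = v then 2 * B - 3 - 4 * (H.degree w : ℤ) else 0) := by
    intro w
    rw [SimpleGraph.degree_of_eq_sup_edge hH' huv h]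
    by_cases hu : w = u
    · have hv : w ≠ v := fun hv => huv (hu ▸ hv)
      simp only [if_pos hu, if_neg hv]
      push_cast
      ring
    · by_cases hv : w = v
      · simp only [if_neg hu, if_pos hv]
        push_cast
        ring
      · simp [hu, hv]
  rw [Finset.sum_congr rfl fun w _ => h1 w, Finset.sum_add_distrib, Finset.sum_add_distrib,
    Finset.sum_ite_eq', Finset.sum_ite_eq']
  simp only [Finset.mem_univ, if_true]
  ring

/-- Every graph has an edge-degree constrained subgraph. -/
theorem exists_edgeDegreeConstrained_subgraph (F : SimpleGraph V) (B : ℕ) :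
    ∃ H ≤ F, (∀ u v, H.Adj u v → H.degree u + H.degree v ≤ B) ∧
      ∀ u v, F.Adj u v → ¬ H.Adj u v → B ≤ H.degree u + H.degree v + 1 := by
  obtain ⟨H, hHF, hmax⟩ := Finset.exists_max_image
    (Finset.univ.filter fun H : SimpleGraph V => H ≤ F)
    (fun H => ∑ w, ((2 * (B : ℤ) - 1) * (H.degree w : ℤ) - 2 * (H.degree w : ℤ) ^ 2))
    ⟨⊥, by simp⟩
  have hHF := (Finset.mem_filter.1 hHF).2
  refine ⟨H, hHF, fun u v huv => ?_, fun u v hF huv => ?_⟩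
  · by_contra hcon
    have hn : ¬ (H \ SimpleGraph.edge u v).Adj u v := by
      simp [SimpleGraph.edge_adj, huv.ne]
    have hH : (H \ SimpleGraph.edge u v) ⊔ SimpleGraph.edge u v = H := by
      rw [sdiff_sup_self, sup_eq_left, SimpleGraph.edge_le_iff]
      exact Or.inr huv
    have h1 := sum_potential_of_eq_sup_edge hH.symm huv.ne hn B
    have h2 := SimpleGraph.degree_of_eq_sup_edge hH.symm huv.ne hn u
    have h3 := SimpleGraph.degree_of_eq_sup_edge hH.symm huv.ne hn v
    simp only [if_true, if_neg huv.ne, if_neg huv.ne.symm] at h2 h3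
    have h4 := hmax (H \ SimpleGraph.edge u v)
      (Finset.mem_filter.2 ⟨Finset.mem_univ _, sdiff_le.trans hHF⟩)
    omega
  · by_contra hcon
    have h1 := sum_potential_of_eq_sup_edge rfl hF.ne huv B
    have h4 := hmax (H ⊔ SimpleGraph.edge u v)
      (Finset.mem_filter.2 ⟨Finset.mem_univ _,
        sup_le hHF ((SimpleGraph.edge_le_iff _).2 (Or.inr hF))⟩)
    omega

end EdgeDegreeConstrained

/-! ### Learning sampled edges and simulating on a subgraph. -/

namespace QueryAlgorithm

variable {n : ℕ}

/-- Query the pairs of the list `l`, add those that are edges to `E`, and continue with `k`. -/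
noncomputable def learn : List (Fin n × Fin n) → Finset (Fin n × Fin n) →
    (Finset (Fin n × Fin n) → QueryAlgorithm n) → QueryAlgorithm n
  | [], E, k => k E
  | e :: l, E, k =>
    if h : e.1 ≠ e.2 then query e.1 e.2 h (learn l (insert e E) k) (learn l E k)
    else learn l E k

theorem learn_spec (G : SimpleGraph (Fin n)) [DecidableRel G.Adj]
    (l : List (Fin n × Fin n)) (E : Finset (Fin n × Fin n))
    (k : Finset (Fin n × Fin n) → QueryAlgorithm n) :
    (learn l E k).result G = (k (E ∪ l.toFinset.filter fun e => G.Adj e.1 e.2)).result G ∧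
      (learn l E k).queries G ≤
        l.length + (k (E ∪ l.toFinset.filter fun e => G.Adj e.1 e.2)).queries G := by
  induction l generalizing E with
  | nil => simp [learn]
  | cons e l ih =>
    by_cases h : G.Adj e.1 e.2
    · have h1 : E ∪ (e :: l).toFinset.filter (fun e => G.Adj e.1 e.2) =
          insert e E ∪ l.toFinset.filter (fun e => G.Adj e.1 e.2) := by
        rw [List.toFinset_cons, Finset.filter_insert, if_pos h, Finset.union_insert,
          Finset.insert_union]
      rw [h1]
      obtain ⟨h2, h3⟩ := ih (insert e E)
      simp only [learn, dif_pos h.ne, result, queries, if_pos h, h2, List.length_cons]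
      exact ⟨trivial, by omega⟩
    · have h1 : E ∪ (e :: l).toFinset.filter (fun e => G.Adj e.1 e.2) =
          E ∪ l.toFinset.filter (fun e => G.Adj e.1 e.2) := by
        rw [List.toFinset_cons, Finset.filter_insert, if_neg h]
      rw [h1]
      obtain ⟨h2, h3⟩ := ih E
      by_cases hne : e.1 ≠ e.2
      · simp only [learn, dif_pos hne, result, queries, if_neg h, h2, List.length_cons]
        exact ⟨trivial, by omega⟩
      · simp only [learn, dif_neg hne, h2, List.length_cons]
        exact ⟨trivial, by omega⟩

open scoped Classical in
/-- Simulate an algorithm on the graph obtained by keeping only the edges that satisfy `P`. -/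
noncomputable def mask (P : Fin n → Fin n → Prop) : QueryAlgorithm n → QueryAlgorithm n
  | output a => output a
  | query u v h yes no =>
    query u v h (if P u v then mask P yes else mask P no) (mask P no)

/-- A pair violating `P` is still queried and its answer discarded, hence equal query counts. -/
theorem mask_eq {G G' : SimpleGraph (Fin n)} [DecidableRel G.Adj] [DecidableRel G'.Adj]
    {P : Fin n → Fin n → Prop} (h : ∀ u v, G'.Adj u v ↔ G.Adj u v ∧ P u v)
    (t : QueryAlgorithm n) :
    (t.mask P).result G = t.result G' ∧ (t.mask P).queries G = t.queries G' := by
  induction t with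
  | output a => exact ⟨rfl, rfl⟩
  | query u v huv yes no ihy ihn =>
    by_cases h1 : G.Adj u v <;> by_cases h2 : P u v <;>
      simp [mask, result, queries, h, h1, h2, ihy, ihn]

end QueryAlgorithm

/-! ### Composition of random choices and tail bounds for uniform samples. -/

section Probability

theorem PMF.toOuterMeasure_le_one {α : Type*} (p : PMF α) (S : Set α) :
    p.toOuterMeasure S ≤ 1 := by
  rw [PMF.toOuterMeasure_apply, ← p.tsum_coe]
  exact ENNReal.tsum_le_tsum fun a => Set.indicator_le_self _ _ a

/-- A bad first outcome costs its probability, a good one at most `b`; failures of successive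
choices therefore add. -/
theorem PMF.toOuterMeasure_bind_le {α β : Type*} (p : PMF α) (f : α → PMF β) {S : Set β}
    {B : Set α} {b : ℝ≥0∞} (h : ∀ a ∉ B, (f a).toOuterMeasure S ≤ b) :
    (p.bind f).toOuterMeasure S ≤ p.toOuterMeasure B + b := by
  rw [PMF.toOuterMeasure_bind_apply, PMF.toOuterMeasure_apply]
  calc _ ≤ ∑' a, (B.indicator p a + p a * b) := by
        refine ENNReal.tsum_le_tsum fun a => ?_
        by_cases ha : a ∈ B
        · rw [Set.indicator_of_mem ha]
          exact ((mul_le_mul_right (PMF.toOuterMeasure_le_one (f a) S) (p a)).trans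
            (mul_one _).le).trans le_self_add
        · exact (mul_le_mul_right (h a ha) (p a)).trans le_add_self
    _ = _ := by rw [ENNReal.tsum_add, ENNReal.tsum_mul_right, p.tsum_coe, one_mul]

/-- Markov's inequality for the uniform distribution on a finite type. -/
theorem toOuterMeasure_uniformOfFintype_le {α : Type*} [Fintype α] [Nonempty α] {S : Set α}
    {g : α → ℝ} {x : ℝ} (hg : ∀ a, 0 ≤ g a) (hS : ∀ a ∈ S, 1 ≤ g a)
    (hx : ∑ a, g a ≤ x * Fintype.card α) :
    (PMF.uniformOfFintype α).toOuterMeasure S ≤ ENNReal.ofReal x := by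
  classical
  rw [PMF.toOuterMeasure_uniformOfFintype_apply]
  have h1 : (Fintype.card S : ℝ) ≤ x * Fintype.card α := by
    refine le_trans ?_ hx
    rw [Fintype.card_ofFinset, ← Finset.sum_boole]
    refine Finset.sum_le_sum fun a _ => ?_
    split_ifs with h
    · exact hS a (by simpa using h)
    · exact hg a
  have h2 : (0 : ℝ) < Fintype.card α := by exact_mod_cast Fintype.card_pos
  rw [ENNReal.div_le_iff (by simp) (by simp), ← ENNReal.ofReal_natCast (Fintype.card α),
    ← ENNReal.ofReal_mul' h2.le, ← ENNReal.ofReal_natCast]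
  exact ENNReal.ofReal_le_ofReal h1

variable {P : Type*} [Fintype P] [Nonempty P] {s : ℕ}

/-- The moment generating function of the number of hits factorises over the samples, and `1 + t ≤
exp t` bounds each factor. `y = 0` yields the probability of missing `W`, `y = e` the upper tail. -/
theorem sum_prod_ite_le (W : Finset P) [DecidableEq P] {y : ℝ} (hy : 0 ≤ y) :
    ∑ ω : Fin s → P, ∏ i, (if ω i ∈ W then y else 1) ≤
      Real.exp (s * (W.card * (y - 1) / Fintype.card P)) * Fintype.card (Fin s → P) := by
  have hN : (0 : ℝ) < Fintype.card P := by exact_mod_cast Fintype.card_pos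
  have h1 : ∑ a : P, (if a ∈ W then y else 1) = Fintype.card P + W.card * (y - 1) := by
    have : ∀ a : P, (if a ∈ W then y else (1 : ℝ)) = 1 + if a ∈ W then y - 1 else 0 := by
      intro a
      split_ifs <;> ring
    simp only [this, Finset.sum_add_distrib, Finset.sum_ite_mem, Finset.univ_inter]
    simp [mul_sub]
  rw [← Fintype.sum_pow (fun a : P => if a ∈ W then y else 1), Fintype.card_fun, Fintype.card_fin,
    Real.exp_nat_mul, Nat.cast_pow, ← mul_pow]
  refine pow_le_pow_left₀ (Finset.sum_nonneg fun a _ => by split_ifs <;> linarith) ?_ _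
  rw [h1]
  have h2 := Real.add_one_le_exp (W.card * (y - 1) / Fintype.card P : ℝ)
  have h3 := mul_le_mul_of_nonneg_right h2 hN.le
  refine le_trans (le_of_eq ?_) h3
  field_simp
  ring

theorem uniform_miss_le (W : Finset P) :
    (PMF.uniformOfFintype (Fin s → P)).toOuterMeasure {ω | ∀ i, ω i ∉ W} ≤
      ENNReal.ofReal (Real.exp (-(s * W.card / Fintype.card P))) := by
  classical
  refine toOuterMeasure_uniformOfFintype_le
    (g := fun ω => ∏ i, (if ω i ∈ W then 0 else 1)) (fun ω => ?_) (fun ω hω => ?_) ?_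
  · exact Finset.prod_nonneg fun i _ => by split_ifs <;> norm_num
  · rw [Finset.prod_eq_one fun i _ => if_neg (hω i)]
  · refine (sum_prod_ite_le W le_rfl).trans (le_of_eq ?_)
    congr 2
    ring

theorem uniform_hits_le [DecidableEq P] (W : Finset P) (m : ℝ) :
    (PMF.uniformOfFintype (Fin s → P)).toOuterMeasure
        {ω | m ≤ (Finset.univ.filter fun i => ω i ∈ W).card} ≤
      ENNReal.ofReal (Real.exp (2 * (s * W.card / Fintype.card P) - m)) := by
  refine toOuterMeasure_uniformOfFintype_le
    (g := fun ω => Real.exp (-m) * ∏ i, (if ω i ∈ W then Real.exp 1 else 1))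
    (fun ω => ?_) (fun ω hω => ?_) ?_
  · refine mul_nonneg (Real.exp_pos _).le (Finset.prod_nonneg fun i _ => ?_)
    split_ifs
    · exact (Real.exp_pos _).le
    · norm_num
  · rw [Finset.prod_ite, Finset.prod_const, Finset.prod_const_one, mul_one, ← Real.exp_nat_mul,
      mul_one, ← Real.exp_add]
    rw [Real.one_le_exp_iff]
    have : m ≤ (Finset.univ.filter fun i => ω i ∈ W).card := hω
    linarith
  · rw [← Finset.mul_sum]
    refine (mul_le_mul_of_nonneg_left (sum_prod_ite_le W (Real.exp_pos 1).le)
      (Real.exp_pos _).le).trans ?_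
    rw [← mul_assoc, ← Real.exp_add]
    refine mul_le_mul_of_nonneg_right (Real.exp_le_exp.2 ?_) (by positivity)
    have h1 : Real.exp 1 - 1 ≤ 2 := by linarith [Real.exp_one_lt_d9]
    have h2 : (s : ℝ) * (W.card * (Real.exp 1 - 1) / Fintype.card P) =
        (Real.exp 1 - 1) * (s * W.card / Fintype.card P) := by ring
    rw [h2]
    have h3 : (0 : ℝ) ≤ s * W.card / Fintype.card P := by positivity
    nlinarith

theorem ofReal_exp_neg_mul_log {n : ℕ} (hn : 0 < n) (k : ℕ) :
    ENNReal.ofReal (Real.exp (-(k * Real.log n))) = ((n : ℝ≥0∞) ^ k)⁻¹ := by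
  have h : (0 : ℝ) < n := by exact_mod_cast hn
  rw [Real.exp_neg, Real.exp_nat_mul, Real.exp_log h, ENNReal.ofReal_inv_of_pos (by positivity),
    ENNReal.ofReal_pow h.le, ENNReal.ofReal_natCast]

/-- With high probability, the sampled pairs hit the pairs of `W` at every vertex that is in many
of them. -/
theorem uniform_miss_vertex_le {V : Type*} [Fintype V] [DecidableEq V] [Nonempty V] (W : Finset (V × V)) (s : ℕ) (D : ℝ) :
    (PMF.uniformOfFintype (Fin s → V × V)).toOuterMeasure
        {ω | ∃ v : V, D ≤ (W.filter fun e => e.1 = v).card ∧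
          ∀ i, ω i ∉ W.filter fun e => e.1 = v} ≤
      ENNReal.ofReal (Real.exp (Real.log (Fintype.card V) -
        s * D / (Fintype.card V : ℝ) ^ 2)) := by
  have hV : (0 : ℝ) < Fintype.card V := by exact_mod_cast Fintype.card_pos
  rw [Set.ofPred_exists]
  calc _ ≤ ∑ v : V, (PMF.uniformOfFintype (Fin s → V × V)).toOuterMeasure
          {ω | D ≤ (W.filter fun e => e.1 = v).card ∧ ∀ i, ω i ∉ W.filter fun e => e.1 = v} :=
        MeasureTheory.measure_iUnion_fintype_le _ _
    _ ≤ ∑ _v : V, ENNReal.ofReal (Real.exp (-(s * D / (Fintype.card V : ℝ) ^ 2))) := by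
        refine Finset.sum_le_sum fun v _ => ?_
        by_cases hx : D ≤ (W.filter fun e => e.1 = v).card
        · simp only [hx, true_and]
          refine (uniform_miss_le _).trans (ENNReal.ofReal_le_ofReal (Real.exp_le_exp.2 ?_))
          rw [Fintype.card_prod, Nat.cast_mul, ← pow_two]
          gcongr
        · simp [hx]
    _ = _ := by
        rw [Finset.sum_const, Finset.card_univ, nsmul_eq_mul, ← ENNReal.ofReal_natCast,
          ← ENNReal.ofReal_mul (by positivity), sub_eq_add_neg, Real.exp_add, Real.exp_log hV]

end Probability

/-! ### Union bound over all candidate subgraphs. -/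

section Underfull

open scoped Classical

variable {V : Type*} [Fintype V]

/-- The ordered pairs that are edges of `G` but not of `H`, and have small degree in `H`. -/
noncomputable def underfullPairs (G H : SimpleGraph V) (B : ℕ) : Finset (V × V) :=
  Finset.univ.filter fun e =>
    G.Adj e.1 e.2 ∧ ¬ H.Adj e.1 e.2 ∧ H.degree e.1 + H.degree e.2 + 1 < B

/-- Give each vertex `B` neighbour slots, padding with the vertex itself, since `fromRel` drops
loops. The union bound runs over these `n^(nB)` codes. -/
theorem exists_fromRel_eq (H : SimpleGraph V) {B : ℕ} (hB : ∀ v, H.degree v ≤ B) :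
    ∃ g : V → Fin B → V, SimpleGraph.fromRel (fun u v => ∃ i, g u i = v) = H := by
  let g : V → Fin B → V := fun v i =>
    if h : i.1 < (H.neighborFinset v).card then ((H.neighborFinset v).equivFin.symm ⟨i.1, h⟩).1
    else v
  have h1 : ∀ u v, u ≠ v → ((∃ i, g u i = v) ↔ H.Adj u v) := by
    intro u v huv
    constructor
    · rintro ⟨i, rfl⟩
      by_cases h : i.1 < (H.neighborFinset u).card
      · simp only [g, dif_pos h]
        exact (H.mem_neighborFinset _ _).1 ((H.neighborFinset u).equivFin.symm ⟨i.1, h⟩).2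
      · simp only [g, dif_neg h] at huv
        exact absurd rfl huv
    · intro h
      have hv : v ∈ H.neighborFinset u := by simpa using h
      have hlt := ((H.neighborFinset u).equivFin ⟨v, hv⟩).2
      refine ⟨⟨_, hlt.trans_le (hB u)⟩, ?_⟩
      simp only [g, dif_pos hlt, Fin.eta, Equiv.symm_apply_apply]
  refine ⟨g, ?_⟩
  ext u v
  rw [SimpleGraph.fromRel_adj]
  constructor
  · rintro ⟨huv, h | h⟩
    · exact (h1 u v huv).1 h
    · exact ((h1 v u huv.symm).1 h).symm
  · intro h
    exact ⟨h.ne, Or.inl ((h1 u v h.ne).2 h)⟩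

/-- With high probability, the sampled pairs hit the underfull pairs of every subgraph `H` of
bounded degree that has many of them. -/
theorem uniform_miss_underfull_le [Nonempty V] (G : SimpleGraph V) (B s : ℕ) (x : ℝ) :
    (PMF.uniformOfFintype (Fin s → V × V)).toOuterMeasure
        {ω | ∃ H : SimpleGraph V, (∀ v, H.degree v ≤ B) ∧ x ≤ (underfullPairs G H B).card ∧
          ∀ i, ω i ∉ underfullPairs G H B} ≤
      ENNReal.ofReal (Real.exp (Fintype.card V * B * Real.log (Fintype.card V) -
        s * x / (Fintype.card V : ℝ) ^ 2)) := by
  let R : (V → Fin B → V) → SimpleGraph V := fun g => SimpleGraph.fromRel fun u v => ∃ i, g u i = v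
  have hV : (0 : ℝ) < Fintype.card V := by exact_mod_cast Fintype.card_pos
  calc _ ≤ (PMF.uniformOfFintype (Fin s → V × V)).toOuterMeasure
        (⋃ g : V → Fin B → V, {ω | x ≤ (underfullPairs G (R g) B).card ∧
          ∀ i, ω i ∉ underfullPairs G (R g) B}) := by
        refine MeasureTheory.OuterMeasure.mono _ ?_
        rintro ω ⟨H, hH, h1, h2⟩
        obtain ⟨g, rfl⟩ := exists_fromRel_eq H hH
        exact Set.mem_iUnion.2 ⟨g, h1, h2⟩
    _ ≤ ∑ g : V → Fin B → V, (PMF.uniformOfFintype (Fin s → V × V)).toOuterMeasure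
          {ω | x ≤ (underfullPairs G (R g) B).card ∧ ∀ i, ω i ∉ underfullPairs G (R g) B} :=
        MeasureTheory.measure_iUnion_fintype_le _ _
    _ ≤ ∑ _g : V → Fin B → V, ENNReal.ofReal (Real.exp (-(s * x / (Fintype.card V : ℝ) ^ 2))) := by
        refine Finset.sum_le_sum fun g _ => ?_
        by_cases hx : x ≤ (underfullPairs G (R g) B).card
        · simp only [hx, true_and]
          refine (uniform_miss_le _).trans (ENNReal.ofReal_le_ofReal (Real.exp_le_exp.2 ?_))
          rw [Fintype.card_prod, Nat.cast_mul, ← pow_two]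
          gcongr
        · simp [hx]
    _ = _ := by
        rw [Finset.sum_const, Finset.card_univ, nsmul_eq_mul, ← ENNReal.ofReal_natCast,
          ← ENNReal.ofReal_mul (by positivity)]
        congr 1
        rw [sub_eq_add_neg, Real.exp_add]
        congr 1
        rw [Fintype.card_fun, Fintype.card_fun, Fintype.card_fin, ← pow_mul, Nat.cast_pow,
          mul_comm (Fintype.card V : ℝ) B, ← Nat.cast_mul, Real.exp_nat_mul, Real.exp_log hV]

end Underfull

/-! ### The sparsified algorithm and its guarantee. -/

section Estimator

open scoped Classical

variable {n : ℕ}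

/-- An edge-degree constrained subgraph of the graph with edge set `E`. -/
noncomputable def sampledSubgraph (B : ℕ) (E : Finset (Fin n × Fin n)) : SimpleGraph (Fin n) :=
  (exists_edgeDegreeConstrained_subgraph (SimpleGraph.fromRel fun u v => (u, v) ∈ E) B).choose

theorem sampledSubgraph_le (B : ℕ) (E : Finset (Fin n × Fin n)) :
    sampledSubgraph B E ≤ SimpleGraph.fromRel fun u v => (u, v) ∈ E :=
  (exists_edgeDegreeConstrained_subgraph _ B).choose_spec.1

theorem degree_add_degree_sampledSubgraph_le (B : ℕ) (E : Finset (Fin n × Fin n)) (u v : Fin n)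
    (h : (sampledSubgraph B E).Adj u v) :
    (sampledSubgraph B E).degree u + (sampledSubgraph B E).degree v ≤ B :=
  (exists_edgeDegreeConstrained_subgraph _ B).choose_spec.2.1 u v h

theorem le_degree_add_degree_sampledSubgraph {B : ℕ} {E : Finset (Fin n × Fin n)} {u v : Fin n}
    (huv : u ≠ v) (hE : (u, v) ∈ E) (h : ¬ (sampledSubgraph B E).Adj u v) :
    B ≤ (sampledSubgraph B E).degree u + (sampledSubgraph B E).degree v + 1 :=
  (exists_edgeDegreeConstrained_subgraph _ B).choose_spec.2.2 u v
    ((SimpleGraph.fromRel_adj _ _ _).2 ⟨huv, Or.inl hE⟩) h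

/-- The vertices at which the edges of `E` contain an underfull pair. -/
noncomputable def removedVertices (B : ℕ) (H : SimpleGraph (Fin n)) (E : Finset (Fin n × Fin n)) :
    Finset (Fin n) :=
  (E.filter fun e => ¬ H.Adj e.1 e.2 ∧ H.degree e.1 + H.degree e.2 + 1 < B).image Prod.fst

/-- The pairs that are kept: those of `H` and the underfull ones, away from the vertices of `R`. -/
def keepPair (B : ℕ) (H : SimpleGraph (Fin n)) (R : Finset (Fin n)) (u v : Fin n) : Prop :=
  u ∉ R ∧ v ∉ R ∧ (H.Adj u v ∨ H.degree u + H.degree v + 1 < B)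

/-- Sample pairs to build an edge-degree constrained subgraph, sample pairs again to find the
vertices in many underfull edges, and run `t` on the remaining sparse graph. -/
noncomputable def sparsifiedAlgorithm (B : ℕ) {s₁ s₂ : ℕ} (ω₁ : Fin s₁ → Fin n × Fin n)
    (ω₂ : Fin s₂ → Fin n × Fin n) (t : QueryAlgorithm n) : QueryAlgorithm n :=
  .learn (List.ofFn ω₁) ∅ fun E₁ => .learn (List.ofFn ω₂) ∅ fun E₂ =>
    t.mask (keepPair B (sampledSubgraph B E₁) (removedVertices B (sampledSubgraph B E₁) E₂))

/-- The second sample is independent of the first because its tail bounds concern the underfull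
pairs, a set determined by `ω₁`. -/
noncomputable def randomizedSparsifiedAlgorithm [NeZero n] (B s₁ s₂ : ℕ)
    (A : RandomizedQueryAlgorithm n) : RandomizedQueryAlgorithm n :=
  (PMF.uniformOfFintype (Fin s₁ → Fin n × Fin n)).bind fun ω₁ =>
    (PMF.uniformOfFintype (Fin s₂ → Fin n × Fin n)).bind fun ω₂ =>
      A.map (sparsifiedAlgorithm B ω₁ ω₂)

/-- The graph on which `sparsifiedAlgorithm` simulates the given algorithm. -/
def keptGraph (G H : SimpleGraph (Fin n)) (B : ℕ) (R : Finset (Fin n)) : SimpleGraph (Fin n) where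
  Adj u v := G.Adj u v ∧ keepPair B H R u v
  symm := ⟨fun u v h => ⟨h.1.symm, h.2.2.1, h.2.1, by
    rw [H.adj_comm, add_comm (H.degree v)]
    exact h.2.2.2⟩⟩
  loopless := ⟨fun u h => h.1.ne rfl⟩

/-- With no vertex removed, the kept graph contains `H` and all underfull edges, so the 3/2 bound
applies; removing `R` costs at most `|R|`. -/
theorem matchingNumber_le_keptGraph {G H : SimpleGraph (Fin n)} {r : ℕ} (hr : 1 ≤ r) (hHG : H ≤ G)
    (hH : ∀ u v, H.Adj u v → H.degree u + H.degree v ≤ r ^ 2) (R : Finset (Fin n)) :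
    (matchingNumber G : ℝ) ≤
      3 / 2 * (matchingNumber (keptGraph G H (r ^ 2) R) + R.card) + 11 * n / r := by
  have h1 := matchingNumber_le_of_edgeDegree (G := G) (K := keptGraph G H (r ^ 2) ∅) hr
    (fun u v h => ⟨hHG h, by simp, by simp, Or.inl h⟩) hH (fun u v hG hK => by
      by_contra hcon
      exact hK ⟨hG, by simp, by simp, Or.inr (not_le.1 hcon)⟩)
  have h2 : matchingNumber (keptGraph G H (r ^ 2) ∅) ≤
      matchingNumber (keptGraph G H (r ^ 2) R) + R.card :=
    matchingNumber_le_add_card R fun u v hu hv h => ⟨h.1, hu, hv, h.2.2.2⟩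
  have h3 : (matchingNumber (keptGraph G H (r ^ 2) ∅) : ℝ) ≤
      matchingNumber (keptGraph G H (r ^ 2) R) + R.card := by exact_mod_cast h2
  rw [Fintype.card_fin] at h1
  linarith

theorem degree_keptGraph_le {G H : SimpleGraph (Fin n)} {B : ℕ}
    (hH : ∀ u v, H.Adj u v → H.degree u + H.degree v ≤ B) (R : Finset (Fin n)) {D : ℝ}
    (hD : 0 ≤ D)
    (hR : ∀ v ∉ R, (((underfullPairs G H B).filter fun e => e.1 = v).card : ℝ) ≤ D)
    (v : Fin n) : ((keptGraph G H B R).degree v : ℝ) ≤ B + D := by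
  by_cases hv : v ∈ R
  · have : (keptGraph G H B R).degree v = 0 := by
      rw [SimpleGraph.degree_eq_zero]
      intro w hw
      exact hw.2.1 hv
    rw [this]
    push_cast
    positivity
  · have h1 : (keptGraph G H B R).neighborFinset v ⊆ H.neighborFinset v ∪
        ((underfullPairs G H B).filter fun e => e.1 = v).image Prod.snd := by
      intro w hw
      have hw := (SimpleGraph.mem_neighborFinset _ _ _).1 hw
      simp only [Finset.mem_union, SimpleGraph.mem_neighborFinset]
      by_cases h : H.Adj v w
      · exact Or.inl h
      · refine Or.inr (Finset.mem_image.2 ⟨(v, w), ?_, rfl⟩)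
        simp only [underfullPairs, Finset.mem_filter, Finset.mem_univ, true_and, and_true]
        exact ⟨hw.1, h, hw.2.2.2.resolve_left h⟩
    have h2 := (Finset.card_le_card h1).trans (Finset.card_union_le _ _)
    have h3 := Finset.card_image_le (s := (underfullPairs G H B).filter fun e => e.1 = v)
      (f := Prod.snd)
    rw [SimpleGraph.card_neighborFinset_eq_degree, SimpleGraph.card_neighborFinset_eq_degree] at h2
    have h4 := degree_le_of_edgeDegree_le hH v
    have h5 : (keptGraph G H B R).degree v ≤
        B + ((underfullPairs G H B).filter fun e => e.1 = v).card := by omega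
    have h6 : ((keptGraph G H B R).degree v : ℝ) ≤
        B + (((underfullPairs G H B).filter fun e => e.1 = v).card : ℝ) := by exact_mod_cast h5
    linarith [hR v hv]

theorem sparsifiedAlgorithm_spec {r s₁ s₂ : ℕ} (ω₁ : Fin s₁ → Fin n × Fin n)
    (ω₂ : Fin s₂ → Fin n × Fin n) (G : SimpleGraph (Fin n)) {E₁ E₂ : Finset (Fin n × Fin n)}
    (hE₁ : (List.ofFn ω₁).toFinset.filter (fun e => G.Adj e.1 e.2) = E₁)
    (hE₂ : (List.ofFn ω₂).toFinset.filter (fun e => G.Adj e.1 e.2) = E₂)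
    {H G' : SimpleGraph (Fin n)} (hH : sampledSubgraph (r ^ 2) E₁ = H)
    (hG' : G' = keptGraph G H (r ^ 2) (removedVertices (r ^ 2) H E₂)) (t : QueryAlgorithm n) :
    (sparsifiedAlgorithm (r ^ 2) ω₁ ω₂ t).result G = t.result G' ∧
      (sparsifiedAlgorithm (r ^ 2) ω₁ ω₂ t).queries G ≤ s₁ + s₂ + t.queries G' := by
  obtain ⟨hres₁, hq₁⟩ := QueryAlgorithm.learn_spec G (List.ofFn ω₁) ∅ fun E₁ =>
    .learn (List.ofFn ω₂) ∅ fun E₂ => t.mask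
      (keepPair (r ^ 2) (sampledSubgraph (r ^ 2) E₁)
        (removedVertices (r ^ 2) (sampledSubgraph (r ^ 2) E₁) E₂))
  obtain ⟨hres₂, hq₂⟩ := QueryAlgorithm.learn_spec G (List.ofFn ω₂) ∅ fun E₂ => t.mask
      (keepPair (r ^ 2) H (removedVertices (r ^ 2) H E₂))
  obtain ⟨hres₃, hq₃⟩ := QueryAlgorithm.mask_eq (G := G) (G' := G')
    (P := keepPair (r ^ 2) H (removedVertices (r ^ 2) H E₂)) (fun u v => by rw [hG']; rfl) t
  rw [Finset.empty_union, hE₁, hH] at hres₁ hq₁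
  rw [Finset.empty_union, hE₂] at hres₂ hq₂
  rw [List.length_ofFn] at hq₁ hq₂
  rw [hq₃] at hq₂
  exact ⟨hres₁.trans (hres₂.trans hres₃), (hq₁.trans (Nat.add_le_add_left hq₂ _)).trans
    (by rw [Nat.add_assoc])⟩

theorem mem_sampled_edges_iff (G : SimpleGraph (Fin n)) {s : ℕ} (ω : Fin s → Fin n × Fin n)
    (e : Fin n × Fin n) :
    e ∈ (List.ofFn ω).toFinset.filter (fun e => G.Adj e.1 e.2) ↔
      (∃ i, ω i = e) ∧ G.Adj e.1 e.2 := by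
  rw [Finset.mem_filter, List.mem_toFinset, List.mem_ofFn]

/-- If the samples hit all the large sets of underfull pairs, and few underfull pairs in total, then
`sparsifiedAlgorithm` simulates `t` on a subgraph of small maximum degree with nearly the same
matching number. -/
theorem exists_sparsifiedAlgorithm_eq [NeZero n] {r s₁ s₂ : ℕ} (hr : 1 ≤ r)
    {ω₁ : Fin s₁ → Fin n × Fin n} {G : SimpleGraph (Fin n)} {x : ℝ}
    (hω₁ : ∀ H : SimpleGraph (Fin n), (∀ v, H.degree v ≤ r ^ 2) →
      x ≤ (underfullPairs G H (r ^ 2)).card → ∃ i, ω₁ i ∈ underfullPairs G H (r ^ 2)) :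
    ∃ U : Finset (Fin n × Fin n), (U.card : ℝ) ≤ x ∧
      ∀ (ω₂ : Fin s₂ → Fin n × Fin n) (D m : ℝ), 0 ≤ D →
        (∀ v, D ≤ (U.filter fun e => e.1 = v).card → ∃ i, ω₂ i ∈ U.filter fun e => e.1 = v) →
        ((Finset.univ.filter fun i => ω₂ i ∈ U).card : ℝ) ≤ m →
        ∃ G' ≤ G, (G'.maxDegree : ℝ) ≤ (r ^ 2 : ℕ) + D ∧
          (matchingNumber G : ℝ) ≤ 3 / 2 * (matchingNumber G' + m) + 11 * n / r ∧
          ∀ t, (sparsifiedAlgorithm (r ^ 2) ω₁ ω₂ t).result G = t.result G' ∧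
            (sparsifiedAlgorithm (r ^ 2) ω₁ ω₂ t).queries G ≤ s₁ + s₂ + t.queries G' := by
  obtain ⟨E₁, hE₁⟩ : ∃ E₁, (List.ofFn ω₁).toFinset.filter (fun e => G.Adj e.1 e.2) = E₁ := ⟨_, rfl⟩
  have hmem₁ := mem_sampled_edges_iff G ω₁
  rw [hE₁] at hmem₁
  obtain ⟨H, hH⟩ : ∃ H, sampledSubgraph (r ^ 2) E₁ = H := ⟨_, rfl⟩
  have hHdeg : ∀ u v, H.Adj u v → H.degree u + H.degree v ≤ r ^ 2 := by
    rw [← hH]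
    exact degree_add_degree_sampledSubgraph_le _ _
  have hHG : H ≤ G := by
    rw [← hH]
    refine (sampledSubgraph_le _ _).trans ?_
    intro u v h
    rcases ((SimpleGraph.fromRel_adj _ _ _).1 h).2 with h | h
    · exact ((hmem₁ _).1 h).2
    · exact ((hmem₁ _).1 h).2.symm
  obtain ⟨U, hU⟩ : ∃ U, underfullPairs G H (r ^ 2) = U := ⟨_, rfl⟩
  have hUmem : ∀ e, e ∈ U ↔
      G.Adj e.1 e.2 ∧ ¬ H.Adj e.1 e.2 ∧ H.degree e.1 + H.degree e.2 + 1 < r ^ 2 := by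
    intro e
    rw [← hU, underfullPairs, Finset.mem_filter, and_iff_right (Finset.mem_univ _)]
  refine ⟨U, ?_, fun ω₂ D m hD hω₂ hm => ?_⟩
  -- A sampled edge outside `H` satisfies the lower degree bound of `H`, so it cannot be underfull.
  · by_contra hcon
    obtain ⟨i, hi⟩ := hω₁ H (degree_le_of_edgeDegree_le hHdeg) (by rw [hU]; exact (not_le.1 hcon).le)
    rw [hU, hUmem] at hi
    have h1 := le_degree_add_degree_sampledSubgraph (B := r ^ 2) (E := E₁) hi.1.ne
      ((hmem₁ _).2 ⟨⟨i, rfl⟩, hi.1⟩) (by rw [hH]; exact hi.2.1)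
    rw [hH] at h1
    exact absurd hi.2.2 (not_lt.2 h1)
  obtain ⟨E₂, hE₂⟩ : ∃ E₂, (List.ofFn ω₂).toFinset.filter (fun e => G.Adj e.1 e.2) = E₂ := ⟨_, rfl⟩
  have hmem₂ := mem_sampled_edges_iff G ω₂
  rw [hE₂] at hmem₂
  obtain ⟨R, hR⟩ : ∃ R, removedVertices (r ^ 2) H E₂ = R := ⟨_, rfl⟩
  have hRmem : ∀ i, ω₂ i ∈ U → (ω₂ i).1 ∈ R := by
    intro i hi
    rw [hUmem] at hi
    rw [← hR]
    exact Finset.mem_image.2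
      ⟨ω₂ i, Finset.mem_filter.2 ⟨(hmem₂ _).2 ⟨⟨i, rfl⟩, hi.1⟩, hi.2⟩, rfl⟩
  have hRcard : (R.card : ℝ) ≤ m := by
    -- Each sampled underfull pair removes only its first vertex.
    have h1 : R ⊆ (Finset.univ.filter fun i => ω₂ i ∈ U).image fun i => (ω₂ i).1 := by
      intro v hv
      rw [← hR] at hv
      obtain ⟨e, he, rfl⟩ := Finset.mem_image.1 hv
      obtain ⟨he, he'⟩ := Finset.mem_filter.1 he
      obtain ⟨⟨i, rfl⟩, hG⟩ := (hmem₂ _).1 he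
      exact Finset.mem_image.2 ⟨i, Finset.mem_filter.2 ⟨Finset.mem_univ _,
        (hUmem _).2 ⟨hG, he'⟩⟩, rfl⟩
    have h2 := (Finset.card_le_card h1).trans Finset.card_image_le
    have h3 : (R.card : ℝ) ≤ (Finset.univ.filter fun i => ω₂ i ∈ U).card := by exact_mod_cast h2
    exact h3.trans hm
  have hRD : ∀ v ∉ R, ((U.filter fun e => e.1 = v).card : ℝ) ≤ D := by
    intro v hv
    by_contra hcon
    obtain ⟨i, hi⟩ := hω₂ v (not_le.1 hcon).le
    obtain ⟨h1, h2⟩ := Finset.mem_filter.1 hi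
    refine hv ?_
    rw [← h2]
    exact hRmem i h1
  rw [← hU] at hRD
  refine ⟨keptGraph G H (r ^ 2) R, fun u v h => h.1, ?_, ?_, ?_⟩
  · have : Nonempty (Fin n) := ⟨0⟩
    obtain ⟨v, hv⟩ := (keptGraph G H (r ^ 2) R).exists_maximal_degree_vertex
    rw [hv]
    exact degree_keptGraph_le hHdeg R hD hRD v
  · refine (matchingNumber_le_keptGraph hr hHG hHdeg R).trans ?_
    gcongr
  · exact sparsifiedAlgorithm_spec ω₁ ω₂ G hE₁ hE₂ hH (by rw [hR])

/-- The guarantee of `randomizedSparsifiedAlgorithm`, given one for `A` on graphs of small maximum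
degree. -/
theorem toOuterMeasure_randomizedSparsifiedAlgorithm_le [NeZero n] {r s₁ s₂ : ℕ} (hr : 1 ≤ r)
    {A : RandomizedQueryAlgorithm n} {x D m η Y : ℝ} (hD : 0 ≤ D) {b : ℝ≥0∞}
    (hA : ∀ G : SimpleGraph (Fin n), (G.maxDegree : ℝ) ≤ (r ^ 2 : ℕ) + D →
      A.toOuterMeasure {t | ¬ (IsMatchingApprox G 1 η (t.result G) ∧ (t.queries G : ℝ) ≤ Y)} ≤ b)
    (G : SimpleGraph (Fin n)) :
    (randomizedSparsifiedAlgorithm (r ^ 2) s₁ s₂ A).toOuterMeasure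
        {t | ¬ (IsMatchingApprox G (3 / 2) (3 / 2 * (η + m) + 11 * n / r) (t.result G) ∧
          (t.queries G : ℝ) ≤ s₁ + s₂ + Y)} ≤
      ENNReal.ofReal (Real.exp (n * (r ^ 2 : ℕ) * Real.log n - s₁ * x / (n : ℝ) ^ 2)) +
      (ENNReal.ofReal (Real.exp (Real.log n - s₂ * D / (n : ℝ) ^ 2)) +
        ENNReal.ofReal (Real.exp (2 * (s₂ * x / (n : ℝ) ^ 2) - m)) + b) := by
  have hmiss := uniform_miss_underfull_le G (r ^ 2) s₁ x
  rw [Fintype.card_fin] at hmiss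
  refine (PMF.toOuterMeasure_bind_le _ _ fun ω₁ hω₁ => ?_).trans (add_le_add_left hmiss _)
  obtain ⟨U, hUx, hU⟩ := exists_sparsifiedAlgorithm_eq (s₂ := s₂) (G := G) (x := x) hr
    (ω₁ := ω₁) (by
      intro H h1 h2
      by_contra hcon
      exact hω₁ ⟨H, h1, h2, not_exists.1 hcon⟩)
  have hvert := uniform_miss_vertex_le U s₂ D
  have hhits := uniform_hits_le (s := s₂) U m
  rw [Fintype.card_fin] at hvert
  have hhits' : ENNReal.ofReal (Real.exp (2 * (s₂ * U.card / Fintype.card (Fin n × Fin n)) - m)) ≤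
      ENNReal.ofReal (Real.exp (2 * (s₂ * x / (n : ℝ) ^ 2) - m)) := by
    refine ENNReal.ofReal_le_ofReal (Real.exp_le_exp.2 ?_)
    rw [Fintype.card_prod, Fintype.card_fin, Nat.cast_mul, ← pow_two]
    gcongr
  refine (PMF.toOuterMeasure_bind_le _ _ (b := b) fun ω₂ hω₂ => ?_).trans
    (add_le_add_left ((MeasureTheory.measure_union_le _ _).trans
      (add_le_add hvert (hhits.trans hhits'))) _)
  rw [Set.mem_union, not_or] at hω₂
  obtain ⟨hω₂, hm⟩ := hω₂
  obtain ⟨G', hG', hdeg, hμ, ht⟩ := hU ω₂ D m hD (by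
    intro v hv
    by_contra hcon
    exact hω₂ ⟨v, hv, not_exists.1 hcon⟩) (not_le.1 hm).le
  rw [PMF.toOuterMeasure_map_apply]
  refine le_trans (MeasureTheory.OuterMeasure.mono _ ?_) (hA _ hdeg)
  intro t hbad hgood
  refine hbad ?_
  obtain ⟨⟨hlow, hup⟩, hq⟩ := hgood
  obtain ⟨hres, hqs⟩ := ht t
  have hmono : (matchingNumber G' : ℝ) ≤ matchingNumber G := by
    exact_mod_cast matchingNumber_mono hG'
  have hqs : ((sparsifiedAlgorithm (r ^ 2) ω₁ ω₂ t).queries G : ℝ) ≤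
      s₁ + s₂ + t.queries G' := by exact_mod_cast hqs
  rw [← hres] at hlow hup
  exact ⟨⟨hlow.trans hmono, by linarith⟩, by linarith⟩

end Estimator

/-! ### Exponents and elementary estimates. -/

section Parameters

theorem one_le_rpow_one_div_one_add {q y : ℝ} (hq : 0 ≤ q) (hy : 1 ≤ y) :
    1 ≤ y ^ (1 / (1 + q)) ∧ y ^ (1 / (1 + q)) ≤ y := by
  refine ⟨Real.one_le_rpow hy (by positivity), ?_⟩
  conv_rhs => rw [← Real.rpow_one y]
  refine Real.rpow_le_rpow_of_exponent_le hy ?_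
  rw [div_le_one (by linarith)]
  linarith

/-- With `d = y^(1/(1+q))`, this is the sampling cost `y²/d`; the next lemma gives the same value
for the simulation cost `y d^q`. -/
theorem sq_div_rpow_one_div {q y : ℝ} (hy : 1 ≤ y) :
    y ^ 2 / y ^ (1 / (1 + q)) = y ^ (2 - 1 / (1 + q)) := by
  rw [Real.rpow_sub (by linarith), Real.rpow_two]

theorem mul_rpow_one_div_rpow {q y : ℝ} (hq : 0 ≤ q) (hy : 1 ≤ y) :
    y * (y ^ (1 / (1 + q))) ^ q = y ^ (2 - 1 / (1 + q)) := by
  have hy0 : 0 < y := by linarith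
  rw [← Real.rpow_mul hy0.le]
  nth_rewrite 1 [← Real.rpow_one y]
  rw [← Real.rpow_add hy0]
  congr 1
  field_simp
  ring

theorem eventually_log_le (a b δ : ℝ) (ha : 0 < a) (hδ : 0 < δ) :
    ∃ n₀ : ℕ, ∀ n : ℕ, n₀ ≤ n → a * Real.log n + b ≤ δ * n := by
  have h1 := (Real.isLittleO_log_id_atTop.bound (c := δ / (2 * a)) (by positivity)).and
    (Filter.eventually_ge_atTop (max 1 (2 * b / δ)))
  have h2 := (tendsto_natCast_atTop_atTop (R := ℝ)).eventually h1
  obtain ⟨n₀, hn₀⟩ := Filter.eventually_atTop.1 h2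
  refine ⟨n₀, fun n hn => ?_⟩
  obtain ⟨h3, h4⟩ := hn₀ n hn
  have h5 : (1 : ℝ) ≤ n := (le_max_left _ _).trans h4
  have h6 : 2 * b / δ ≤ n := (le_max_right _ _).trans h4
  rw [Real.norm_of_nonneg (Real.log_nonneg h5), id, Real.norm_of_nonneg (by linarith)] at h3
  rw [div_le_iff₀ hδ] at h6
  have h7 := mul_le_mul_of_nonneg_left h3 ha.le
  have h8 : a * (δ / (2 * a) * n) = δ * n / 2 := by field_simp
  linarith

theorem four_mul_inv_pow_le {n : ℕ} (hn : 2 ≤ n) (c : ℕ) :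
    4 * ((n : ℝ≥0∞) ^ (c + 2))⁻¹ ≤ ((n : ℝ≥0∞) ^ c)⁻¹ := by
  have h0 : (n : ℝ≥0∞) ^ c ≠ 0 := pow_ne_zero _ (by norm_cast; omega)
  have h1 : (n : ℝ≥0∞) ^ c ≠ ∞ := ENNReal.pow_ne_top (ENNReal.natCast_ne_top n)
  rw [← div_eq_mul_inv]
  refine ENNReal.div_le_of_le_mul ?_
  rw [pow_add, ENNReal.inv_mul_cancel_left h0 h1]
  have h2 : 4 ≤ n ^ 2 := by nlinarith
  exact_mod_cast h2

end Parameters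

/-! ### Choice of parameters and the final reduction. -/

section Reduction

open scoped Classical

/-- Probability at most `n ^ (-c)` of failing to be an `(α, ε n)`-approximation or of using more
than `Y` queries, on every input graph. -/
def FailsRarely {n : ℕ} (A : RandomizedQueryAlgorithm n) (c : ℕ) (α ε : ℝ)
    (Y : SimpleGraph (Fin n) → ℝ) : Prop :=
  ∀ G : SimpleGraph (Fin n), A.toOuterMeasure
    {t | ¬ (IsMatchingApprox G α (ε * n) (t.result G) ∧ (t.queries G : ℝ) ≤ Y G)} ≤
      ((n : ℝ≥0∞) ^ c)⁻¹

/-- The output is at least `-εn/4`, so replacing `a` by `3a/2` loses at most `εn/8`. -/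
theorem FailsRarely.three_halves {n : ℕ} (hn : 0 < n) {A : RandomizedQueryAlgorithm n} {c : ℕ}
    {ε : ℝ} {Y : SimpleGraph (Fin n) → ℝ} {Z : ℝ}
    (hA : FailsRarely A (c + 2) 1 (ε / 4) Y) (hε : 0 < ε) (hZ : ∀ G, Y G ≤ Z) :
    FailsRarely A c (3 / 2) ε fun _ => Z := by
  intro G
  refine le_trans (MeasureTheory.OuterMeasure.mono _ ?_) ((hA G).trans ?_)
  · intro t ht hgood
    refine ht ?_
    obtain ⟨⟨hlow, hup⟩, hq⟩ := hgood
    refine ⟨⟨hlow, ?_⟩, hq.trans (hZ G)⟩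
    have h1 : (0 : ℝ) ≤ matchingNumber G := by positivity
    have h2 : 0 ≤ ε * n := by positivity
    linarith
  · rw [ENNReal.inv_le_inv]
    exact pow_le_pow_right₀ (by exact_mod_cast hn) (by omega)

theorem FailsRarely.randomizedSparsifiedAlgorithm {n : ℕ} [NeZero n] (hn2 : 2 ≤ n) {q ε : ℝ}
    (hq : 0 ≤ q) (hε : 0 < ε) {c k r : ℕ} (hr : 1 ≤ r) (hrε : 22 / ε ≤ r)
    (hn : (c + 2) * Real.log n + 2 ≤ ε / 12 * n)
    {A : RandomizedQueryAlgorithm n} {C : ℝ}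
    (hA : FailsRarely A (c + 2) 1 (ε / 6) fun G =>
      C * (n * max 1 (G.maxDegree : ℝ) ^ q) * (1 + Real.log n) ^ k) :
    ∃ A' : RandomizedQueryAlgorithm n, FailsRarely A' c (3 / 2) ε fun _ =>
      (r ^ 2 + c + 4 + ε / 24 + |C| * (r ^ 2 + 24 * (c + 3) / ε) ^ q) *
        (n : ℝ) ^ (2 - 1 / (1 + q)) * (1 + Real.log n) ^ (k + (⌈q⌉₊ + 1)) := by
  have hn1 : (1 : ℝ) ≤ n := by exact_mod_cast (show 1 ≤ n by omega)
  have hn0 : (0 : ℝ) < n := by linarith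
  have hlog : 0 ≤ Real.log n := Real.log_nonneg hn1
  obtain ⟨hd1, hdn⟩ := one_le_rpow_one_div_one_add hq hn1
  have hT1 := sq_div_rpow_one_div (q := q) hn1
  have hT2 := mul_rpow_one_div_rpow hq hn1
  obtain ⟨d, hd⟩ : ∃ d, d = (n : ℝ) ^ (1 / (1 + q)) := ⟨_, rfl⟩
  obtain ⟨T, hT⟩ : ∃ T, T = (n : ℝ) ^ (2 - 1 / (1 + q)) := ⟨_, rfl⟩
  obtain ⟨L, hL⟩ : ∃ L, L = 1 + Real.log n := ⟨_, rfl⟩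
  obtain ⟨K, hK⟩ : ∃ K : ℝ, K = 24 * (c + 3) / ε := ⟨_, rfl⟩
  rw [← hd] at hd1 hdn hT1 hT2
  rw [← hT] at hT1 hT2
  simp only [← hT, ← hL, ← hK]
  have hd0 : 0 < d := by linarith
  have hK0 : 0 < K := by rw [hK]; positivity
  have hL1 : 1 ≤ L := by linarith
  have hTpos : 1 ≤ T := by
    rw [← hT1, one_le_div hd0]
    nlinarith
  have hr1 : (1 : ℝ) ≤ r := by exact_mod_cast hr
  have hB1 : (1 : ℝ) ≤ (r : ℝ) ^ 2 := one_le_pow₀ hr1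
  -- A set of `d n` pairs is missed with exponent at least `(r² + c + 2) n L`; the `r²` part pays
  -- for the union bound over `H`.
  let s₁ : ℕ := ⌈((r : ℝ) ^ 2 + c + 2) * T * L⌉₊
  -- Large enough to hit every vertex in `K d L` underfull pairs, small enough to hit at most `εn/24
  -- + 1` of `d n` pairs on average.
  let s₂ : ℕ := ⌈(c + 3) * T / K⌉₊
  have hs₁ : ((r : ℝ) ^ 2 + c + 2) * T * L ≤ s₁ := Nat.le_ceil _
  have hs₁' : (s₁ : ℝ) ≤ ((r : ℝ) ^ 2 + c + 2) * T * L + 1 :=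
    (Nat.ceil_lt_add_one (by positivity)).le
  have hs₂ : (c + 3) * T / K ≤ s₂ := Nat.le_ceil _
  have hs₂' : (s₂ : ℝ) ≤ (c + 3) * T / K + 1 := (Nat.ceil_lt_add_one (by positivity)).le
  have hTd : T * d = (n : ℝ) ^ 2 := by rw [← hT1]; field_simp
  have hKc : (c + 3) / K = ε / 24 := by rw [hK]; field_simp
  refine ⟨_root_.randomizedSparsifiedAlgorithm (r ^ 2) s₁ s₂ A, fun G => ?_⟩
  -- Error budget: `3/2 (ε/6 + ε/6) = ε/2` from simulation and deletion, and `11/r ≤ ε/2` from the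
  -- sparsifier.
  have hmain := toOuterMeasure_randomizedSparsifiedAlgorithm_le (s₁ := s₁) (s₂ := s₂) hr (A := A)
    (x := d * n) (D := K * d * L) (m := ε / 6 * n) (η := ε / 6 * n)
    (Y := |C| * (n * ((r ^ 2 + K) * d * L) ^ q) * L ^ k) (by positivity)
    (b := ((n : ℝ≥0∞) ^ (c + 2))⁻¹) (by
      intro G hG
      refine le_trans (MeasureTheory.OuterMeasure.mono _ ?_) (hA G)
      intro t ht hgood
      refine ht ⟨hgood.1, hgood.2.trans ?_⟩
      rw [← hL]
      have h1 : max 1 (G.maxDegree : ℝ) ≤ (r ^ 2 + K) * d * L := by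
        have h2 : 1 ≤ d * L := one_le_mul_of_one_le_of_one_le hd1 hL1
        have h3 : (r : ℝ) ^ 2 ≤ r ^ 2 * (d * L) := le_mul_of_one_le_right (by positivity) h2
        have h4 : 0 ≤ K * d * L := by positivity
        push_cast at hG
        refine max_le ?_ ?_
        · linarith
        · linarith
      beta_reduce
      gcongr
      exact le_abs_self C) G
  refine le_trans (MeasureTheory.OuterMeasure.mono _ ?_) (hmain.trans ?_)
  · intro t ht hgood
    refine ht ?_
    obtain ⟨⟨hlow, hup⟩, hqr⟩ := hgood
    refine ⟨⟨hlow, hup.trans ?_⟩, hqr.trans ?_⟩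
    · have h1 : 11 * (n : ℝ) / r ≤ ε / 2 * n := by
        rw [div_le_iff₀ (by linarith)]
        rw [div_le_iff₀ hε] at hrε
        nlinarith
      linarith
    · have h1 : ((r ^ 2 + K) * d * L) ^ q ≤ (r ^ 2 + K) ^ q * d ^ q * L ^ ⌈q⌉₊ := by
        rw [Real.mul_rpow (by positivity) (by linarith), Real.mul_rpow (by positivity) hd0.le]
        refine mul_le_mul_of_nonneg_left ?_ (by positivity)
        rw [← Real.rpow_natCast]
        exact Real.rpow_le_rpow_of_exponent_le hL1 (Nat.le_ceil q)
      -- Of the extra powers of `L`, `⌈q⌉₊` come from the degree bound and one from `s₁`.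
      have hLk : L ≤ L ^ (k + (⌈q⌉₊ + 1)) := le_self_pow₀ hL1 (by omega)
      have hLk1 : 1 ≤ L ^ (k + (⌈q⌉₊ + 1)) := one_le_pow₀ hL1
      have h2 : |C| * (n * ((r ^ 2 + K) * d * L) ^ q) * L ^ k ≤
          |C| * (r ^ 2 + K) ^ q * T * L ^ (k + (⌈q⌉₊ + 1)) := by
        calc |C| * (n * ((r ^ 2 + K) * d * L) ^ q) * L ^ k ≤
              |C| * (n * ((r ^ 2 + K) ^ q * d ^ q * L ^ ⌈q⌉₊)) * L ^ k := by gcongr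
          _ = |C| * (r ^ 2 + K) ^ q * (n * d ^ q) * L ^ (k + ⌈q⌉₊) := by rw [pow_add]; ring
          _ ≤ _ := by
              rw [hT2]
              gcongr
              · exact Nat.le_succ _
      have hTL : 1 ≤ T * L ^ (k + (⌈q⌉₊ + 1)) := one_le_mul_of_one_le_of_one_le hTpos hLk1
      have h3 : ((r : ℝ) ^ 2 + c + 2) * T * L ≤
          ((r : ℝ) ^ 2 + c + 2) * T * L ^ (k + (⌈q⌉₊ + 1)) := by gcongr
      have h4 : (c + 3) * T / K ≤ ε / 24 * (T * L ^ (k + (⌈q⌉₊ + 1))) := by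
        rw [mul_div_right_comm, hKc]
        refine mul_le_mul_of_nonneg_left ?_ (by positivity)
        exact le_mul_of_one_le_right (by linarith) hLk1
      linarith
  -- Four failure terms of at most `n^(-(c+2))` each; `n² ≥ 4` absorbs the factor 4.
  · have hy := ofReal_exp_neg_mul_log (n := n) (by omega) (c + 2)
    refine le_trans (add_le_add ?_ (add_le_add (add_le_add ?_ ?_) le_rfl)) (b :=
      ((n : ℝ≥0∞) ^ (c + 2))⁻¹ + (((n : ℝ≥0∞) ^ (c + 2))⁻¹ + ((n : ℝ≥0∞) ^ (c + 2))⁻¹ +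
        ((n : ℝ≥0∞) ^ (c + 2))⁻¹)) ?_
    · rw [← hy]
      refine ENNReal.ofReal_le_ofReal (Real.exp_le_exp.2 ?_)
      have h1 : ((r : ℝ) ^ 2 + c + 2) * n * L ≤ s₁ * (d * n) / (n : ℝ) ^ 2 := by
        rw [le_div_iff₀ (by positivity)]
        calc ((r : ℝ) ^ 2 + c + 2) * n * L * (n : ℝ) ^ 2 =
              ((r : ℝ) ^ 2 + c + 2) * T * L * (d * n) := by rw [← hTd]; ring
          _ ≤ _ := by gcongr
      have h2 : ((r : ℝ) ^ 2 + c + 2) * n * Real.log n ≤ ((r : ℝ) ^ 2 + c + 2) * n * L := by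
        gcongr
        linarith
      have h3 : ((c : ℝ) + 2) * Real.log n ≤ ((c : ℝ) + 2) * Real.log n * n :=
        le_mul_of_one_le_right (by positivity) hn1
      push_cast
      linarith
    · rw [← hy]
      refine ENNReal.ofReal_le_ofReal (Real.exp_le_exp.2 ?_)
      have h1 : ((c : ℝ) + 3) * L ≤ s₂ * (K * d * L) / (n : ℝ) ^ 2 := by
        rw [le_div_iff₀ (by positivity)]
        calc ((c : ℝ) + 3) * L * (n : ℝ) ^ 2 = (c + 3) * T / K * (K * d * L) := by
              rw [← hTd]; field_simp
          _ ≤ _ := by gcongr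
      have h2 : ((c : ℝ) + 3) * Real.log n ≤ ((c : ℝ) + 3) * L := by
        gcongr
        linarith
      push_cast
      linarith
    · rw [← hy]
      refine ENNReal.ofReal_le_ofReal (Real.exp_le_exp.2 ?_)
      -- The `+ 1` comes from rounding `s₂`. The exponent is then at most `2 - εn/12`, which `hn`
      -- controls.
      have h1 : s₂ * (d * n) / (n : ℝ) ^ 2 ≤ ε / 24 * n + 1 := by
        rw [div_le_iff₀ (by positivity)]
        calc s₂ * (d * n) ≤ ((c + 3) * T / K + 1) * (d * n) := by gcongr
          _ = (c + 3) / K * (T * d) * n + d * n := by ring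
          _ ≤ ε / 24 * (n : ℝ) ^ 2 * n + n * n := by
              rw [hKc, hTd]
              gcongr
          _ = _ := by ring
      push_cast
      linarith
    · refine le_trans (le_of_eq ?_) (four_mul_inv_pow_le hn2 c)
      ring

/-- One constant must serve all `n`: for the finitely many `n` below the threshold, the given
algorithm itself is used, with the degree bounded by `n₀ + 2`. Positivity is assumed inside the
existentials so that the chosen algorithm depends on `ε` and `n` alone. -/
theorem exists_failsRarely_three_halves {q : ℝ} (hq : 0 ≤ q) {k c : ℕ}
    {A : ℝ → (n : ℕ) → RandomizedQueryAlgorithm n} {C : ℝ → ℝ}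
    (hF : ∀ ε > 0, ∀ n : ℕ, 0 < n → FailsRarely (A ε n) (c + 2) 1 ε fun G =>
      C ε * (n * max 1 (G.maxDegree : ℝ) ^ q) * (1 + Real.log n) ^ k) (ε : ℝ) :
    ∃ C' : ℝ, ∀ n : ℕ, ∃ A' : RandomizedQueryAlgorithm n, 0 < ε → 0 < n →
      FailsRarely A' c (3 / 2) ε fun _ =>
        C' * (n : ℝ) ^ (2 - 1 / (1 + q)) * (1 + Real.log n) ^ (k + (⌈q⌉₊ + 1)) := by
  by_cases hε : 0 < ε
  swap
  · exact ⟨0, fun n => ⟨PMF.pure (.output 0), fun h => absurd h hε⟩⟩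
  obtain ⟨n₀, hn₀⟩ := eventually_log_le (c + 2) 2 (ε / 12) (by positivity) (by positivity)
  obtain ⟨r, hr⟩ : ∃ r : ℕ, r = ⌈22 / ε⌉₊ := ⟨_, rfl⟩
  have hr1 : 1 ≤ r := by
    rw [hr]
    exact Nat.one_le_ceil_iff.2 (by positivity)
  have hrε : 22 / ε ≤ r := by
    rw [hr]
    exact Nat.le_ceil _
  let M : ℝ := r ^ 2 + c + 4 + ε / 24 + |C (ε / 6)| * (r ^ 2 + 24 * (c + 3) / ε) ^ q
  let M' : ℝ := |C (ε / 4)| * ((n₀ + 2) * (n₀ + 2 : ℝ) ^ q)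
  refine ⟨max M M', fun n => ?_⟩
  rcases Nat.eq_zero_or_pos n with rfl | hn
  · exact ⟨PMF.pure (.output 0), fun _ h => absurd h (lt_irrefl _)⟩
  have hn1 : (1 : ℝ) ≤ n := by exact_mod_cast hn
  have hlog : 0 ≤ Real.log n := Real.log_nonneg hn1
  by_cases hbig : max 2 n₀ ≤ n
  · have : NeZero n := ⟨hn.ne'⟩
    obtain ⟨A', hA'⟩ := (hF (ε / 6) (by positivity) n hn).randomizedSparsifiedAlgorithm
      ((le_max_left _ _).trans hbig) hq hε hr1 hrε (hn₀ n ((le_max_right _ _).trans hbig))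
    refine ⟨A', fun _ _ G => le_trans (MeasureTheory.OuterMeasure.mono _ ?_) (hA' G)⟩
    intro t ht hgood
    refine ht ⟨hgood.1, hgood.2.trans ?_⟩
    beta_reduce
    gcongr
    exact le_max_left M M'
  · refine ⟨A (ε / 4) n, fun _ _ =>
      (hF (ε / 4) (by positivity) n hn).three_halves hn hε fun G => ?_⟩
    have hnlt : n ≤ n₀ + 2 := by omega
    have hnlt' : (n : ℝ) ≤ n₀ + 2 := by exact_mod_cast hnlt
    have hdeg : max 1 (G.maxDegree : ℝ) ≤ n₀ + 2 := by
      refine max_le (by linarith) ?_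
      have : Nonempty (Fin n) := ⟨⟨0, hn⟩⟩
      have h1 := G.maxDegree_lt_card_verts
      rw [Fintype.card_fin] at h1
      exact_mod_cast (show G.maxDegree ≤ n₀ + 2 by omega)
    have hT : 1 ≤ (n : ℝ) ^ (2 - 1 / (1 + q)) := by
      refine Real.one_le_rpow hn1 ?_
      have : 1 / (1 + q) ≤ 1 := by
        rw [div_le_one (by linarith)]
        linarith
      linarith
    calc C (ε / 4) * (n * max 1 (G.maxDegree : ℝ) ^ q) * (1 + Real.log n) ^ k
        ≤ M' * (1 + Real.log n) ^ k := by
          simp only [M']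
          gcongr
          exact le_abs_self _
      _ ≤ max M M' * (1 + Real.log n) ^ (k + (⌈q⌉₊ + 1)) := by
          gcongr
          · exact le_max_right _ _
          · linarith
          · omega
      _ ≤ _ := by
          refine mul_le_mul_of_nonneg_right ?_ (by positivity)
          exact le_mul_of_one_le_right (le_max_of_le_right (by positivity)) hT

end Reduction

/-- If some randomized adjacency-matrix query algorithm gives, with high probability, a
`(1, ε n)`-approximation to `μ(G)` with `Õ_ε(n Δ ^ q)` queries, then some randomized
adjacency-matrix query algorithm gives, with high probability, a `(3/2, ε n)`-approximation to
`μ(G)` with `Õ_ε(n ^ (2 - 1 / (1 + q)))` queries. The maximum degree is replaced by `max 1 Δ`, so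
that the hypothesis does not ask for zero queries on a graph without edges. -/
theorem corollary1p4 (q : ℝ) (hq : 0 ≤ q)
    (hA : EstimatesMatchingWHP 1 (fun n Δ => (n : ℝ) * (max 1 (Δ : ℝ)) ^ q)) :
    EstimatesMatchingWHP (3 / 2) (fun n _ => (n : ℝ) ^ (2 - 1 / (1 + q))) := by
  obtain ⟨k, hk⟩ := hA
  refine ⟨k + (⌈q⌉₊ + 1), fun c => ?_⟩
  obtain ⟨A, C, hAC⟩ := hk (c + 2)
  choose C' A' hA' using exists_failsRarely_three_halves hq
    (hF := fun ε hε n hn G => @hAC ε hε n hn G fun a b => Classical.propDecidable (G.Adj a b))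
  refine ⟨A', C', fun ε hε n hn G inst => ?_⟩
  have hinst : inst = fun a b => Classical.propDecidable (G.Adj a b) := Subsingleton.elim _ _
  subst hinst
  exact hA' ε n hε hn G
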